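/- For a class $\mathcal H$ of directed graphs, the problem Directed Steiner $\mathcal H$-Network ($\mathcal H$-DSN) is the following. Given are a directed graph $G$ with non-negative integer arc weights, a set $R\subseteq V(G)$ of terminals, a directed graph $H\in\mathcal H$ with vertex set $R$ (the pattern), and a number $b$; the question is whether there is a subgraph $N\subseteq G$ of total arc weight at most $b$ that contains a directed $s\to t$ path for every arc $st$ of $H$. (This is the decision version of the problem of finding such an $N$ of minimum weight.) The parameter is the number $|R|$ of terminals. For $\alpha\ge 1$, a pure $\alpha$-out-diamond is a directed graph whose vertex set consists of two distinct vertices $r_1,r_2$ and a set $L$ of $\alpha$ further vertices, and whose arcs are exactly $r_1\ell$ and $r_2\ell$ for all $\ell\in L$ (two out-stars with the common leaf set $L$). A pure $\alpha$-in-diamond is obtained by reversing all arcs. A pure out-diamond (in-diamond) is a pure $\alpha$-out-diamond (pure $\alpha$-in-diamond) for some $\alpha\ge1$. A parameterized problem $P$ reduces to a parameterized problem $Q$ if there are computable functions $f,g$, a constant $c$, and an algorithm that maps every instance $x$ of $P$ with parameter $k$, in time $f(k)\cdot(|x|+1)^{c}$, to an instance $x'$ of $Q$ with parameter at most $g(k)$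 such that $x$ is a yes-instance if and only if $x'$ is. W[1] is the class of all parameterized problems that, for some constant $d$, reduce to the problem of deciding whether a given Boolean circuit of depth at most $d$ and weft at most $1$ (at most one gate of in-degree greater than two on every path from an input to the output) has a satisfying assignment with exactly $k$ true inputs, parameterized by $k$. A problem is W[1]-hard if every problem in W[1] reduces to it. Lemma. If $\mathcal H$ is the class of all pure out-diamonds, then $\mathcal H$-DSN is W[1]-hard parameterized by the number of terminals. The same holds if $\mathcal H$ is the class of all pure in-diamonds. -/

import Mathlib

/-! ### Random access machines with a step count -/

namespace RAM

/-- Memory of a random access machine: finitely many scalar registers and finitely many arrays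
(those named in the program), all holding natural numbers, and a write-only output tape. -/
structure State where
  var : ℕ → ℕ
  arr : ℕ → ℕ → ℕ
  out : List ℕ

/-- Expressions: constants, registers, array cells, addition and (truncated) subtraction. -/
inductive Expr where
  | lit (c : ℕ)
  | var (x : ℕ)
  | get (a : ℕ) (i : Expr)
  | add (e₁ e₂ : Expr)
  | sub (e₁ e₂ : Expr)

def Expr.eval (σ : State) : Expr → ℕ
  | .lit c => c
  | .var x => σ.var x
  | .get a i => σ.arr a (i.eval σ)
  | .add e₁ e₂ => e₁.eval σ + e₂.eval σ
  | .sub e₁ e₂ => e₁.eval σ - e₂.eval σ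

/-- Number of elementary operations needed to evaluate an expression (uniform cost; since there is
no multiplication, this is polynomially related to the number of bit operations). -/
def Expr.cost : Expr → ℕ
  | .lit _ => 1
  | .var _ => 1
  | .get _ i => i.cost + 1
  | .add e₁ e₂ => e₁.cost + e₂.cost + 1
  | .sub e₁ e₂ => e₁.cost + e₂.cost + 1

/-- Programs. The tests of `ite` and `while` ask whether the value is nonzero. -/
inductive Prog where
  | skip
  | assign (x : ℕ) (e : Expr)
  | store (a : ℕ) (i e : Expr)
  | write (e : Expr)
  | seq (p q : Prog)
  | ite (e : Expr) (p q : Prog)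
  | while (e : Expr) (p : Prog)

def State.setVar (σ : State) (x v : ℕ) : State :=
  { σ with var := Function.update σ.var x v }

def State.setArr (σ : State) (a i v : ℕ) : State :=
  { σ with arr := Function.update σ.arr a (Function.update (σ.arr a) i v) }

def State.append (σ : State) (v : ℕ) : State :=
  { σ with out := σ.out ++ [v] }

/-- `Runs p σ τ t`: started in state `σ`, the program `p` halts in state `τ` after exactly `t`
elementary steps. -/
inductive Runs : Prog → State → State → ℕ → Prop where
  | skip (σ : State) : Runs .skip σ σ 1
  | assign (x : ℕ) (e : Expr) (σ : State) :
      Runs (.assign x e) σ (σ.setVar x (e.eval σ)) (e.cost + 1)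
  | store (a : ℕ) (i e : Expr) (σ : State) :
      Runs (.store a i e) σ (σ.setArr a (i.eval σ) (e.eval σ)) (i.cost + e.cost + 1)
  | write (e : Expr) (σ : State) :
      Runs (.write e) σ (σ.append (e.eval σ)) (e.cost + 1)
  | seq {p q : Prog} {σ τ υ : State} {s t : ℕ} :
      Runs p σ τ s → Runs q τ υ t → Runs (.seq p q) σ υ (s + t)
  | ite_true {e : Expr} {p q : Prog} {σ τ : State} {t : ℕ} :
      e.eval σ ≠ 0 → Runs p σ τ t → Runs (.ite e p q) σ τ (e.cost + 1 + t)
  | ite_false {e : Expr} {p q : Prog} {σ τ : State} {t : ℕ} :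
      e.eval σ = 0 → Runs q σ τ t → Runs (.ite e p q) σ τ (e.cost + 1 + t)
  | while_true {e : Expr} {p : Prog} {σ τ υ : State} {s t : ℕ} :
      e.eval σ ≠ 0 → Runs p σ τ s → Runs (.while e p) τ υ t →
        Runs (.while e p) σ υ (e.cost + 1 + s + t)
  | while_false {e : Expr} {p : Prog} {σ : State} :
      e.eval σ = 0 → Runs (.while e p) σ σ (e.cost + 1)

/-- Initial memory on an input word: its length is in register `0`, its letters are in array `0`,
everything else is zero, and the output tape is empty. -/
def State.init (w : List ℕ) : State where
  var := fun x => if x = 0 then w.length else 0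
  arr := fun a i => if a = 0 then w.getD i 0 else 0
  out := []

end RAM

/-! ### Parameterized problems, reductions, and the class W[1] -/

namespace Param

/-- Length in binary of a word over the natural numbers (each letter with a separator). -/
def bitSize (w : List ℕ) : ℕ := (w.map fun a => Nat.size a + 1).sum

/-- A parameterized decision problem: instances with their parameter and their (unambiguous)
encoding, and the set of yes-instances. -/
structure Problem where
  Inst : Type
  param : Inst → ℕ
  encode : Inst → List ℕ
  yes : Inst → Prop
  encode_injective : ∀ i j, param i = param j → encode i = encode j → i = j

/-- The input word of an instance: the parameter followed by the encoding. -/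
def Problem.word (P : Problem) (i : P.Inst) : List ℕ := P.param i :: P.encode i

/-- Parameterized (fpt, many-one) reducibility: `r` preserves the answer, the new parameter is at
most `g (k)`, and `r` is computed in at most `f (k) * (n + 1) ^ c` steps, where `k` is the parameter
and `n` the encoding length of the given instance, and `f`, `g` are computable. -/
def Reducible (P Q : Problem) : Prop :=
  ∃ (r : P.Inst → Q.Inst) (p : RAM.Prog) (f g : ℕ → ℕ) (c : ℕ),
    Computable f ∧ Computable g ∧
    (∀ i, P.yes i ↔ Q.yes (r i)) ∧
    (∀ i, Q.param (r i) ≤ g (P.param i)) ∧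
    ∀ i, ∃ (τ : RAM.State) (t : ℕ),
      RAM.Runs p (RAM.State.init (P.word i)) τ t ∧
      τ.out = Q.word (r i) ∧
      t ≤ f (P.param i) * (bitSize (P.encode i) + 1) ^ c

/-- Non-input nodes of a Boolean circuit, with the list of the nodes that they read. -/
inductive Gate where
  | not (j : ℕ)
  | and (js : List ℕ)
  | or (js : List ℕ)

def Gate.args : Gate → List ℕ
  | .not j => [j]
  | .and js => js
  | .or js => js

/-- And- and or-gates have at least two, pairwise distinct, in-neighbours. -/
def Gate.Proper : Gate → Prop
  | .not _ => True
  | .and js => 2 ≤ js.length ∧ js.Nodup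
  | .or js => 2 ≤ js.length ∧ js.Nodup

/-- A Boolean circuit (acyclic, listed in a topological order): the nodes `0, …, inputs - 1` are the
input nodes, the node `inputs + i` is the `i`-th gate and reads only earlier nodes. -/
structure Circuit where
  inputs : ℕ
  gates : List Gate
  output : ℕ
  proper : ∀ g ∈ gates, g.Proper
  args_lt : ∀ (i : ℕ) (h : i < gates.length), ∀ j ∈ (gates[i]).args, j < inputs + i
  output_lt : output < inputs + gates.length

/-- The table of all node labels obtained by labelling the gates in order, the label of a gate
being computed from the table of the labels of the earlier nodes. -/
def Circuit.table {α : Type} (C : Circuit) (base : List α) (step : Gate → List α → α) : List α :=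
  C.gates.foldl (fun tbl g => tbl ++ [step g tbl]) base

def Gate.value (tbl : List Bool) : Gate → Bool
  | .not j => !(tbl.getD j false)
  | .and js => js.all fun j => tbl.getD j false
  | .or js => js.any fun j => tbl.getD j false

/-- Value of the output node under an assignment of the input nodes. -/
def Circuit.value (C : Circuit) (x : Fin C.inputs → Bool) : Bool :=
  (C.table (List.ofFn x) fun g tbl => g.value tbl).getD C.output false

/-- Maximal length of a path from an input node to the output node. -/
def Circuit.depth (C : Circuit) : ℕ :=
  (C.table (List.replicate C.inputs 0) fun g tbl =>
    (g.args.map fun j => tbl.getD j 0).foldr max 0 + 1).getD C.output 0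

/-- Maximal number of large gates (those with more than two in-neighbours) on a path from an input
node to the output node. -/
def Circuit.weft (C : Circuit) : ℕ :=
  (C.table (List.replicate C.inputs 0) fun g tbl =>
    (g.args.map fun j => tbl.getD j 0).foldr max 0 +
      if 2 < g.args.length then 1 else 0).getD C.output 0

def Gate.encode : Gate → List ℕ
  | .not j => [0, 1, j]
  | .and js => 1 :: js.length :: js
  | .or js => 2 :: js.length :: js

/-- Every input node contributes one letter `0`, every gate its kind, in-degree and
in-neighbours. -/
def Circuit.encode (C : Circuit) : List ℕ :=
  C.inputs :: C.gates.length :: C.output ::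
    (List.replicate C.inputs 0 ++ C.gates.flatMap Gate.encode)

theorem Gate.encode_append_inj {g g' : Gate} {l l' : List ℕ}
    (h : g.encode ++ l = g'.encode ++ l') : g = g' ∧ l = l' := by
  cases g <;> cases g' <;> simp [Gate.encode] at h ⊢
  · exact h
  · exact List.append_inj h.2 h.1
  · exact List.append_inj h.2 h.1

theorem Gate.flatMap_encode_inj : ∀ {gs gs' : List Gate}, gs.length = gs'.length →
    gs.flatMap Gate.encode = gs'.flatMap Gate.encode → gs = gs'
  | [], [], _, _ => rfl
  | [], _ :: _, h, _ => by simp at h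
  | _ :: _, [], h, _ => by simp at h
  | g :: gs, g' :: gs', hl, h => by
    simp only [List.flatMap_cons] at h
    obtain ⟨h1, h2⟩ := Gate.encode_append_inj h
    rw [h1, Gate.flatMap_encode_inj (by simpa using hl) h2]

theorem Circuit.encode_injective {C C' : Circuit} (h : C.encode = C'.encode) : C = C' := by
  obtain ⟨n, gs, o, _, _, _⟩ := C
  obtain ⟨n', gs', o', _, _, _⟩ := C'
  simp only [Circuit.encode, List.cons.injEq] at h
  obtain ⟨h1, h2, h3, h4⟩ := h
  subst h1 h3
  obtain rfl := Gate.flatMap_encode_inj h2 (List.append_cancel_left h4)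
  rfl

/-- An instance of Weighted Circuit Satisfiability for circuits of weft at most one and depth at
most `d`. -/
structure WCSInstance (d : ℕ) where
  circuit : Circuit
  k : ℕ
  weft_le : circuit.weft ≤ 1
  depth_le : circuit.depth ≤ d

/-- Weighted Circuit Satisfiability: is there a satisfying assignment that sets exactly `k` input
nodes to true? The parameter is `k`. -/
def WCS (d : ℕ) : Problem where
  Inst := WCSInstance d
  param I := I.k
  encode I := I.circuit.encode
  yes I := ∃ x : Fin I.circuit.inputs → Bool,
    (Finset.univ.filter fun i => x i = true).card = I.k ∧ I.circuit.value x = true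
  encode_injective := by
    rintro ⟨C, k, _, _⟩ ⟨C', k', _, _⟩ hk h
    obtain rfl := Circuit.encode_injective h
    obtain rfl : k = k' := hk
    rfl

/-- The class W[1]: problems reducible to Weighted Circuit Satisfiability for circuits of weft at
most one and depth at most some constant. -/
def InW1 (P : Problem) : Prop := ∃ d, Reducible P (WCS d)

/-- W[1]-hardness under parameterized reductions. -/
def W1Hard (Q : Problem) : Prop := ∀ P : Problem, InW1 P → Reducible P Q

end Param

/-! ### Directed Steiner networks -/

namespace Steiner

/-- A class of pattern graphs. -/
abbrev PatternClass := ∀ V : Type, Digraph V → Prop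

/-- Pure `α`-out-diamond: two out-stars with distinct roots `r₁`, `r₂` and the common leaf set `L`
of size `α ≥ 1`. -/
def IsPureOutDiamond (α : ℕ) {V : Type} (H : Digraph V) : Prop :=
  1 ≤ α ∧ ∃ (r₁ r₂ : V) (L : Finset V), r₁ ≠ r₂ ∧ r₁ ∉ L ∧ r₂ ∉ L ∧ L.card = α ∧
    (∀ v, v = r₁ ∨ v = r₂ ∨ v ∈ L) ∧
    ∀ u v, H.Adj u v ↔ (u = r₁ ∨ u = r₂) ∧ v ∈ L

/-- Pure `α`-in-diamond: two in-stars with distinct roots `r₁`, `r₂` and the common leaf set `L`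
of size `α ≥ 1`. -/
def IsPureInDiamond (α : ℕ) {V : Type} (H : Digraph V) : Prop :=
  1 ≤ α ∧ ∃ (r₁ r₂ : V) (L : Finset V), r₁ ≠ r₂ ∧ r₁ ∉ L ∧ r₂ ∉ L ∧ L.card = α ∧
    (∀ v, v = r₁ ∨ v = r₂ ∨ v ∈ L) ∧
    ∀ u v, H.Adj u v ↔ u ∈ L ∧ (v = r₁ ∨ v = r₂)

def pureOutDiamonds : PatternClass := fun _ H => ∃ α, IsPureOutDiamond α H

def pureInDiamonds : PatternClass := fun _ H => ∃ α, IsPureInDiamond α H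

/-- An instance of the decision version of Directed Steiner `𝓗`-Network: an arc-weighted directed
graph on the vertices `0, …, n - 1` (`weight u v = none` if there is no arc from `u` to `v`), a set
of terminals, a pattern graph of the class `𝓗` whose vertex set is the set of terminals, and a
bound on the cost. -/
structure Instance (𝓗 : PatternClass) where
  n : ℕ
  weight : Fin n → Fin n → Option ℕ
  terminals : Finset (Fin n)
  pattern : Digraph terminals
  pattern_mem : 𝓗 terminals pattern
  budget : ℕ

/-- The arc set `N` is a network in the given graph that contains an `s → t` path for every arc `st`
of the pattern. -/
def Instance.IsSolution {𝓗 : PatternClass} (I : Instance 𝓗) (N : Finset (Fin I.n × Fin I.n)) :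
    Prop :=
  (∀ e ∈ N, (I.weight e.1 e.2).isSome) ∧
  ∀ s t : I.terminals, I.pattern.Adj s t →
    Relation.ReflTransGen (fun u v => (u, v) ∈ N) (s : Fin I.n) (t : Fin I.n)

def Instance.cost {𝓗 : PatternClass} (I : Instance 𝓗) (N : Finset (Fin I.n × Fin I.n)) : ℕ :=
  ∑ e ∈ N, (I.weight e.1 e.2).getD 0

/-- The word of an `n × n` matrix, row by row. -/
def matrixWord {n : ℕ} (M : Fin n → Fin n → ℕ) : List ℕ :=
  List.ofFn fun i : Fin (n * n) => M i.divNat i.modNat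

theorem matrixWord_injective {n : ℕ} {M M' : Fin n → Fin n → ℕ}
    (h : matrixWord M = matrixWord M') : M = M' := by
  have h := List.ofFn_injective h
  funext u v
  have := congrFun h (finProdFinEquiv (u, v))
  have e : finProdFinEquiv.symm (finProdFinEquiv (u, v)) = (u, v) := Equiv.symm_apply_apply _ _
  simp only [finProdFinEquiv_symm_apply, Prod.mk.injEq] at e
  simpa [e.1, e.2] using this

open Classical in
/-- The number of vertices, the bound on the cost, the terminals (as a `0/1` vector), the arcs with
their weights (`0` for no arc, `w + 1` for an arc of weight `w`) and the arcs of the pattern (as a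
`0/1` matrix). -/
noncomputable def Instance.encode {𝓗 : PatternClass} (I : Instance 𝓗) : List ℕ :=
  I.n :: I.budget ::
    ((List.ofFn fun v => if v ∈ I.terminals then 1 else 0) ++
    (matrixWord (fun u v => match I.weight u v with | none => 0 | some w => w + 1) ++
    matrixWord fun u v =>
      if ∃ (hu : u ∈ I.terminals) (hv : v ∈ I.terminals), I.pattern.Adj ⟨u, hu⟩ ⟨v, hv⟩
      then 1 else 0))

theorem Instance.encode_injective {𝓗 : PatternClass} {I J : Instance 𝓗}
    (h : I.encode = J.encode) : I = J := by
  obtain ⟨n, w, R, H, _, b⟩ := I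
  obtain ⟨n', w', R', H', _, b'⟩ := J
  simp only [Instance.encode, List.cons.injEq] at h
  obtain ⟨h1, h2, h3⟩ := h
  subst h1 h2
  obtain ⟨hR, h4⟩ := List.append_inj h3 (by simp)
  obtain ⟨hw, hH⟩ := List.append_inj h4 (by simp [matrixWord])
  have hR := List.ofFn_injective hR
  have hw := matrixWord_injective hw
  have hH := matrixWord_injective hH
  obtain rfl : R = R' := by
    ext v
    have := congrFun hR v
    by_cases h1 : v ∈ R <;> by_cases h2 : v ∈ R' <;> simp_all
  obtain rfl : w = w' := by
    funext u v
    have := congrFun (congrFun hw u) v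
    cases h1 : w u v <;> cases h2 : w' u v <;> simp_all
  obtain rfl : H = H' := by
    ext ⟨u, hu⟩ ⟨v, hv⟩
    have := congrFun (congrFun hH u) v
    by_cases h1 : H.Adj ⟨u, hu⟩ ⟨v, hv⟩ <;> by_cases h2 : H'.Adj ⟨u, hu⟩ ⟨v, hv⟩ <;> simp_all
  rfl

/-- Directed Steiner `𝓗`-Network (decision version), parameterized by the number of terminals: is
there a network for the pattern whose cost is within the given bound? -/
noncomputable def DSN (𝓗 : PatternClass) : Param.Problem where
  Inst := Instance 𝓗
  param I := I.terminals.card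
  encode := Instance.encode
  yes I := ∃ N, I.IsSolution N ∧ I.cost N ≤ I.budget
  encode_injective _ _ _ h := Instance.encode_injective h

end Steiner

/-! ### Functions and words computed in polynomial time -/

namespace RAM

/-- A read-only array together with a bound on its entries. -/
structure Input where
  data : ℕ → ℕ
  size : ℕ
  le : ∀ i, data i ≤ size

/-- Types whose elements are tuples of numbers held in registers: `Good m rd` says that `rd` reads
its value off registers below `m`, and `wt` is the sum of the components. -/
class Ctx (α : Type) where
  Good : ℕ → ((ℕ → ℕ) → α) → Prop
  wt : α → ℕ
  mono : ∀ {m m' : ℕ} {rd : (ℕ → ℕ) → α}, m ≤ m' → Good m rd → Good m' rd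
  stable : ∀ {m : ℕ} {rd : (ℕ → ℕ) → α} {v v' : ℕ → ℕ}, Good m rd →
    (∀ x < m, v x = v' x) → rd v = rd v'

open Ctx

instance : Ctx ℕ where
  Good m rd := ∃ x < m, rd = fun v => v x
  wt := id
  mono := by
    rintro m m' rd h ⟨x, hx, rfl⟩
    exact ⟨x, hx.trans_le h, rfl⟩
  stable := by
    rintro m rd v v' ⟨x, hx, rfl⟩ h
    exact h x hx

instance {α β : Type} [Ctx α] [Ctx β] : Ctx (α × β) where
  Good m rd := Good m (fun v => (rd v).1) ∧ Good m (fun v => (rd v).2)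
  wt a := wt a.1 + wt a.2
  mono h hg := ⟨mono h hg.1, mono h hg.2⟩
  stable hg h := Prod.ext (stable hg.1 h) (stable hg.2 h)

@[simp] theorem wt_nat (a : ℕ) : wt a = a := rfl

@[simp] theorem wt_pair {α β : Type} [Ctx α] [Ctx β] (a : α × β) : wt a = wt a.1 + wt a.2 := rfl

theorem good_nat {m x : ℕ} (h : x < m) : Good m (fun v : ℕ → ℕ => v x) := ⟨x, h, rfl⟩

theorem Good.push {α : Type} [Ctx α] {m m' x : ℕ} {rd : (ℕ → ℕ) → α} (h : Good m rd)
    (hm : m ≤ m') (hx : x < m') : Good m' (fun v => (rd v, v x)) :=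
  ⟨mono hm h, good_nat hx⟩

variable {α β : Type} [Ctx α] [Ctx β]

/-- Polynomial boundedness in the size of the input and the sum of the arguments. -/
def PolyB (f : Input → α → ℕ) : Prop := ∃ c, ∀ I a, f I a ≤ (I.size + wt a + 2) ^ c

theorem PolyB.mono {f g : Input → α → ℕ} (hg : PolyB g) (h : ∀ I a, f I a ≤ g I a) : PolyB f :=
  hg.imp fun _ hc I a => (h I a).trans (hc I a)

theorem PolyB.const (k : ℕ) : PolyB (fun _ (_ : α) => k) :=
  ⟨k, fun _ _ => k.lt_two_pow_self.le.trans (Nat.pow_le_pow_left (by omega) k)⟩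

theorem PolyB.args : PolyB (fun I (a : α) => I.size + wt a) :=
  ⟨1, fun I a => by rw [pow_one]; exact Nat.le_add_right _ 2⟩

theorem PolyB.size : PolyB (fun I (_ : α) => I.size) := PolyB.args.mono fun _ _ => by simp

theorem PolyB.wt : PolyB (fun _ (a : α) => wt a) := PolyB.args.mono fun _ _ => by simp

theorem PolyB.mul {f g : Input → α → ℕ} (hf : PolyB f) (hg : PolyB g) :
    PolyB (fun I a => f I a * g I a) := by
  obtain ⟨c, hc⟩ := hf
  obtain ⟨c', hc'⟩ := hg
  exact ⟨c + c', fun I a => by rw [pow_add]; exact Nat.mul_le_mul (hc I a) (hc' I a)⟩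

theorem PolyB.add {f g : Input → α → ℕ} (hf : PolyB f) (hg : PolyB g) :
    PolyB (fun I a => f I a + g I a) := by
  obtain ⟨c, hc⟩ := hf
  obtain ⟨c', hc'⟩ := hg
  refine ⟨c + c' + 1, fun I a => ?_⟩
  have hX : 2 ≤ I.size + Ctx.wt a + 2 := by omega
  have hf := hc I a
  have hg := hc' I a
  generalize I.size + Ctx.wt a + 2 = X at hX hf hg
  have h1 : X ^ c ≤ X ^ (c + c') := Nat.pow_le_pow_right (by omega) (by omega)
  have h2 : X ^ c' ≤ X ^ (c + c') := Nat.pow_le_pow_right (by omega) (by omega)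
  calc f I a + g I a ≤ X ^ (c + c') * 2 := by omega
    _ ≤ X ^ (c + c' + 1) := by rw [pow_succ]; exact Nat.mul_le_mul_left _ hX

theorem PolyB.comp {f : Input → β → ℕ} (hf : PolyB f) {g : Input → α → β}
    (hg : PolyB (fun I a => Ctx.wt (g I a))) : PolyB (fun I a => f I (g I a)) := by
  obtain ⟨c, hc⟩ := hf
  obtain ⟨c', hc'⟩ := (PolyB.size.add hg).add (PolyB.const 2)
  refine ⟨c' * c, fun I a => (hc I _).trans ?_⟩
  rw [pow_mul]
  exact Nat.pow_le_pow_left (hc' I a) c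

/-- The program `p` computes `F` into register `m`, with the arguments in registers below `m` and
the input in array `A`, in time `T`. -/
def Impl (A m : ℕ) (rd : (ℕ → ℕ) → α) (p : Prog) (F T : Input → α → ℕ) : Prop :=
  ∀ (I : Input) (σ : State), σ.arr A = I.data → ∃ τ t, Runs p σ τ t ∧
    τ.var m = F I (rd σ.var) ∧ (∀ x < m, τ.var x = σ.var x) ∧ τ.arr = σ.arr ∧ τ.out = σ.out ∧
    t ≤ T I (rd σ.var)

/-- Functions with polynomially bounded values that are computable in polynomial time. -/
def Comp (F : Input → α → ℕ) : Prop :=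
  PolyB F ∧ ∃ T : Input → α → ℕ, PolyB T ∧
    ∀ (A m : ℕ) (rd : (ℕ → ℕ) → α), Good m rd → ∃ p, Impl A m rd p F T

theorem Comp.const (k : ℕ) : Comp (fun _ (_ : α) => k) := by
  refine ⟨.const k, fun _ _ => 2, .const 2, fun A m rd _ => ⟨.assign m (.lit k), ?_⟩⟩
  intro I σ _
  refine ⟨_, _, .assign _ _ _, ?_, ?_, rfl, rfl, le_rfl⟩
  · simp [State.setVar, Expr.eval]
  · intro x hx
    simp [State.setVar, hx.ne]

theorem Comp.proj {π : α → ℕ} (h : ∀ m rd, Good m rd → Good m (fun v => π (rd v)))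
    (hw : ∀ a, π a ≤ wt a) : Comp (fun _ a => π a) := by
  refine ⟨PolyB.wt.mono fun _ => hw, fun _ _ => 2, .const 2, fun A m rd hg => ?_⟩
  obtain ⟨x, _, hx⟩ := h m rd hg
  refine ⟨.assign m (.var x), fun I σ _ => ⟨_, _, .assign _ _ _, ?_, ?_, rfl, rfl, le_rfl⟩⟩
  · simpa [State.setVar, Expr.eval] using (congrFun hx σ.var).symm
  · intro x hx
    simp [State.setVar, hx.ne]

/-- Change of context. -/
theorem Comp.reindex {F : Input → β → ℕ} (hF : Comp F) {π : α → β}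
    (h : ∀ m rd, Good m rd → Good m (fun v => π (rd v))) (hw : ∀ a, wt (π a) ≤ wt a) :
    Comp (fun I a => F I (π a)) := by
  have hπ : PolyB (fun (_ : Input) a => wt (π a)) := PolyB.wt.mono fun _ => hw
  obtain ⟨hB, T, hT, hF⟩ := hF
  exact ⟨hB.comp hπ, fun I a => T I (π a), hT.comp hπ, fun A m rd hg => hF A m _ (h m rd hg)⟩

theorem Comp.weak {F : Input → α → ℕ} (hF : Comp F) : Comp (fun I (a : α × β) => F I a.1) :=
  hF.reindex (fun _ _ h => h.1) fun a => by simp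

theorem Comp.last : Comp (fun _ (a : α × ℕ) => a.2) := .proj (fun _ _ h => h.2) fun a => by simp

/-- Binary operations available as expressions. -/
theorem Comp.op {F G : Input → α → ℕ} (hF : Comp F) (hG : Comp G) (op : Input → ℕ → ℕ → ℕ)
    (e : ℕ → Expr → Expr → Expr)
    (heval : ∀ I A σ x y, State.arr σ A = I.data →
      (e A x y).eval σ = op I (x.eval σ) (y.eval σ))
    (hcost : ∀ A x y, (e A x y).cost ≤ x.cost + y.cost + 1)
    (hop : ∀ I x y, op I x y ≤ I.size + x + y) : Comp (fun I a => op I (F I a) (G I a)) := by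
  obtain ⟨hBF, T, hT, hF⟩ := hF
  obtain ⟨hBG, S, hS, hG⟩ := hG
  refine ⟨((PolyB.size.add hBF).add hBG).mono fun I a => hop _ _ _,
    fun I a => T I a + S I a + 4, (hT.add hS).add (.const 4), fun A m rd hg => ?_⟩
  obtain ⟨p, hp⟩ := hF A m rd hg
  obtain ⟨q, hq⟩ := hG A (m + 1) rd (mono (m.le_add_right 1) hg)
  refine ⟨.seq p (.seq q (.assign m (e A (.var m) (.var (m + 1))))), fun I σ hσ => ?_⟩
  obtain ⟨τ, t, hr, h1, h2, h3, h4, h5⟩ := hp I σ hσ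
  obtain ⟨υ, s, hr', g1, g2, g3, g4, g5⟩ := hq I τ (by rw [h3, hσ])
  have e' : rd τ.var = rd σ.var := stable hg h2
  rw [e'] at g1 g5
  refine ⟨_, _, hr.seq (hr'.seq (.assign _ _ _)), ?_, ?_, g3.trans h3, g4.trans h4, ?_⟩
  · simp only [State.setVar, Function.update_self]
    rw [heval I A υ _ _ (by rw [g3, h3, hσ])]
    simp only [Expr.eval, g1, g2 m (by omega), h1]
  · intro x hx
    rw [← h2 x hx, ← g2 x (by omega)]
    simp [State.setVar, hx.ne]
  · have := hcost A (.var m) (.var (m + 1))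
    simp only [Expr.cost] at this ⊢
    omega

theorem Comp.add {F G : Input → α → ℕ} (hF : Comp F) (hG : Comp G) :
    Comp (fun I a => F I a + G I a) :=
  hF.op hG (fun _ x y => x + y) (fun _ => .add) (fun _ _ _ _ _ _ => rfl) (fun _ _ _ => le_rfl)
    fun _ _ _ => by omega

theorem Comp.sub {F G : Input → α → ℕ} (hF : Comp F) (hG : Comp G) :
    Comp (fun I a => F I a - G I a) :=
  hF.op hG (fun _ x y => x - y) (fun _ => .sub) (fun _ _ _ _ _ _ => rfl) (fun _ _ _ => le_rfl)
    fun _ _ _ => by omega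

theorem Comp.get {F : Input → α → ℕ} (hF : Comp F) : Comp (fun I a => I.data (F I a)) :=
  hF.op hF (fun I x _ => I.data x) (fun A x _ => .get A x)
    (fun I A σ x y h => by simp [Expr.eval, h]) (fun _ _ _ => by simp only [Expr.cost]; omega)
    fun I x _ => (I.le x).trans (by omega)

theorem Comp.cond {F G H : Input → α → ℕ} (hF : Comp F) (hG : Comp G) (hH : Comp H) :
    Comp (fun I a => if F I a ≠ 0 then G I a else H I a) := by
  obtain ⟨-, T, hT, hF⟩ := hF
  obtain ⟨hBG, S, hS, hG⟩ := hG
  obtain ⟨hBH, U, hU, hH⟩ := hH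
  refine ⟨(hBG.add hBH).mono fun I a => by split_ifs <;> omega,
    fun I a => T I a + S I a + U I a + 2, ((hT.add hS).add hU).add (.const 2), fun A m rd hg => ?_⟩
  obtain ⟨p, hp⟩ := hF A m rd hg
  obtain ⟨q, hq⟩ := hG A m rd hg
  obtain ⟨q', hq'⟩ := hH A m rd hg
  refine ⟨.seq p (.ite (.var m) q q'), fun I σ hσ => ?_⟩
  obtain ⟨τ, t, hr, h1, h2, h3, h4, h5⟩ := hp I σ hσ
  have e : rd τ.var = rd σ.var := stable hg h2
  by_cases h : F I (rd σ.var) = 0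
  · obtain ⟨υ, s, hr', g1, g2, g3, g4, g5⟩ := hq' I τ (by rw [h3, hσ])
    refine ⟨_, _, hr.seq (.ite_false (h1.trans h) hr'), ?_, fun x hx => (g2 x hx).trans (h2 x hx),
      g3.trans h3, g4.trans h4, ?_⟩
    · simp [g1, e, h]
    · rw [e] at g5
      simp only [Expr.cost]; omega
  · obtain ⟨υ, s, hr', g1, g2, g3, g4, g5⟩ := hq I τ (by rw [h3, hσ])
    refine ⟨_, _, hr.seq (.ite_true (by simpa [Expr.eval, h1] using h) hr'), ?_,
      fun x hx => (g2 x hx).trans (h2 x hx), g3.trans h3, g4.trans h4, ?_⟩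
    · simp [g1, e, h]
    · rw [e] at g5
      simp only [Expr.cost]; omega

/-- Value of an accumulator after `i` rounds of a loop. -/
def acc (F : Input → α → ℕ) (H : Input → (α × ℕ) × ℕ → ℕ) (I : Input) (a : α) : ℕ → ℕ
  | 0 => F I a
  | i + 1 => H I ((a, i), acc F H I a i)

theorem Comp.fold {F G : Input → α → ℕ} {H : Input → (α × ℕ) × ℕ → ℕ} (hF : Comp F) (hG : Comp G)
    (hH : Comp H) (hR : PolyB (fun I (a : α × ℕ) => acc F H I a.1 a.2)) :
    Comp (fun I a => acc F H I a (G I a)) := by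
  obtain ⟨-, T, hT, hF⟩ := hF
  obtain ⟨hBG, S, hS, hG⟩ := hG
  obtain ⟨-, U, ⟨c, hU⟩, hH⟩ := hH
  obtain ⟨c', hc'⟩ := hR
  have hwG : PolyB (fun I a => wt (a, G I a)) := PolyB.wt.add hBG
  have hV : PolyB (fun I (a : α) =>
      (I.size + wt ((a, G I a), (I.size + wt (a, G I a) + 2) ^ c') + 2) ^ c) := by
    refine PolyB.comp (f := fun I (b : (α × ℕ) × ℕ) => (I.size + Ctx.wt b + 2) ^ c)
      ⟨c, fun _ _ => le_rfl⟩ (g := fun I a => ((a, G I a), (I.size + Ctx.wt (a, G I a) + 2) ^ c')) ?_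
    exact hwG.add (PolyB.comp (f := fun I (b : α × ℕ) => (I.size + Ctx.wt b + 2) ^ c')
      ⟨c', fun _ _ => le_rfl⟩ hwG)
  refine ⟨(PolyB.comp (f := fun I (a : α × ℕ) => acc F H I a.1 a.2) ⟨c', hc'⟩ hwG),
    fun I a => T I a + S I a + 6 + G I a *
      ((I.size + wt ((a, G I a), (I.size + wt (a, G I a) + 2) ^ c') + 2) ^ c + 10),
    ((hT.add hS).add (.const 6)).add (hBG.mul (hV.add (.const 10))), fun A m rd hg => ?_⟩
  obtain ⟨p, hp⟩ := hF A m rd hg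
  obtain ⟨q, hq⟩ := hG A (m + 1) rd (mono (by omega) hg)
  obtain ⟨u, hu⟩ := hH A (m + 3) (fun v => ((rd v, v (m + 2)), v m))
    (Good.push (m' := m + 3) (Good.push (m' := m + 3) hg (by omega) (by omega)) le_rfl (by omega))
  refine ⟨.seq p (.seq q (.seq (.assign (m + 2) (.lit 0))
    (.while (.sub (.var (m + 1)) (.var (m + 2)))
      (.seq u (.seq (.assign m (.var (m + 3)))
        (.assign (m + 2) (.add (.var (m + 2)) (.lit 1)))))))), fun I σ hσ => ?_⟩
  obtain ⟨τ, t, hr, h1, h2, h3, h4, h5⟩ := hp I σ hσ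
  obtain ⟨υ, s, hr', g1, g2, g3, g4, g5⟩ := hq I τ (by rw [h3, hσ])
  have e' : rd τ.var = rd σ.var := stable hg h2
  rw [e'] at g1 g5
  set a := rd σ.var with ha
  set g := G I a with hgdef
  set V := (I.size + wt ((a, g), (I.size + wt (a, g) + 2) ^ c') + 2) ^ c with hVdef
  have loop : ∀ (r i : ℕ) (ρ : State), i + r = g → ρ.arr A = I.data → rd ρ.var = a →
      ρ.var m = acc F H I a i → ρ.var (m + 1) = g → ρ.var (m + 2) = i →
      ∃ ρ' t, Runs (.while (.sub (.var (m + 1)) (.var (m + 2)))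
        (.seq u (.seq (.assign m (.var (m + 3)))
          (.assign (m + 2) (.add (.var (m + 2)) (.lit 1)))))) ρ ρ' t ∧
        ρ'.var m = acc F H I a g ∧ (∀ x < m, ρ'.var x = ρ.var x) ∧ ρ'.arr = ρ.arr ∧
        ρ'.out = ρ.out ∧ t ≤ 4 + r * (V + 10) := by
    intro r
    induction r with
    | zero =>
      intro i ρ hi k1 k2 k3 k4 k5
      refine ⟨_, _, .while_false ?_, ?_, fun _ _ => rfl, rfl, rfl, by simp [Expr.cost]⟩
      · simp only [Expr.eval]; omega
      · rw [k3]; congr 1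
    | succ r ih =>
      intro i ρ hi k1 k2 k3 k4 k5
      obtain ⟨τ', t', l0, l1, l2, l3, l4, l5⟩ := hu I ρ k1
      dsimp only at l1 l5
      rw [k2, k3, k5] at l1 l5
      set ρ' := (τ'.setVar m (τ'.var (m + 3))).setVar (m + 2) (i + 1) with hρ'
      have lr : ∀ x < m, ρ'.var x = ρ.var x := by
        intro x hx
        rw [← l2 x (by omega)]
        simp [hρ', State.setVar, hx.ne, show x ≠ m + 2 by omega]
      obtain ⟨ρ₁, t₁, n0, n1, n2, n3, n4, n5⟩ := ih (i + 1) ρ' (by omega)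
        (by simp [hρ', State.setVar, l3, k1]) (by rw [← k2]; exact stable hg lr)
        (by simp [hρ', State.setVar, l1, acc])
        (by simp [hρ', State.setVar, l2 (m + 1), k4]) (by simp [hρ', State.setVar])
      have run : Runs (.seq u (.seq (.assign m (.var (m + 3)))
          (.assign (m + 2) (.add (.var (m + 2)) (.lit 1))))) ρ ρ' (t' + (2 + 4)) := by
        have := Runs.seq l0 (.seq (.assign m (.var (m + 3)) τ')
          (.assign (m + 2) (.add (.var (m + 2)) (.lit 1)) _))
        simpa [Expr.eval, Expr.cost, State.setVar, hρ', l2 (m + 2), k5] using this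
      refine ⟨ρ₁, _, .while_true (by simp only [Expr.eval]; omega) run n0, n1,
        fun x hx => (n2 x hx).trans (lr x hx), n3.trans (by simp [hρ', State.setVar, l3]),
        n4.trans (by simp [hρ', State.setVar, l4]), ?_⟩
      have : t' ≤ V := by
        refine l5.trans ((hU _ _).trans (Nat.pow_le_pow_left ?_ c))
        have hi' : i ≤ g := by omega
        have : acc F H I a i ≤ (I.size + wt (a, g) + 2) ^ c' :=
          (hc' I (a, i)).trans (Nat.pow_le_pow_left (by simp; omega) c')
        simp only [wt_pair, wt_nat] at this ⊢
        omega
      simp only [Expr.cost, add_mul]; omega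
  have hυ : ∀ x < m, υ.var x = σ.var x := fun x hx => (g2 x (by omega)).trans (h2 x hx)
  obtain ⟨ρ, w, n0, n1, n2, n3, n4, n5⟩ := loop g 0 (υ.setVar (m + 2) 0) (by omega)
    (by simp [State.setVar, g3, h3, hσ])
    (stable hg fun x hx => by
      simp only [State.setVar, Function.update_of_ne (show x ≠ m + 2 by omega), hυ x hx])
    (by simp [State.setVar, g2 m, h1, acc]) (by simp [State.setVar, g1]) (by simp [State.setVar])
  refine ⟨ρ, _, hr.seq (hr'.seq (.seq (.assign _ _ _) n0)), n1, fun x hx => ?_,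
    n3.trans (g3.trans h3), n4.trans (g4.trans h4), ?_⟩
  · rw [n2 x hx, ← hυ x hx]
    simp [State.setVar, show x ≠ m + 2 by omega]
  · change _ ≤ T I a + S I a + 6 + g * (V + 10)
    simp only [Expr.cost]; omega

open Classical in
/-- The truth value of a proposition as a number. -/
noncomputable def ind (p : Prop) : ℕ := if p then 1 else 0

theorem ind_of {p : Prop} (h : p) : ind p = 1 := if_pos h

theorem ind_of_not {p : Prop} (h : ¬p) : ind p = 0 := if_neg h

theorem ind_ne_zero {p : Prop} : ind p ≠ 0 ↔ p := by
  by_cases h : p <;> simp [ind, h]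

theorem ind_le_one (p : Prop) : ind p ≤ 1 := by
  by_cases h : p <;> simp [ind, h]

/-- Properties decidable in polynomial time. -/
def CompP (P : Input → α → Prop) : Prop := Comp (fun I a => ind (P I a))

theorem CompP.of_iff {P Q : Input → α → Prop} (hP : CompP P) (h : ∀ I a, Q I a ↔ P I a) :
    CompP Q := by
  obtain rfl : Q = P := by
    funext I a
    exact propext (h I a)
  exact hP

theorem Comp.ite {P : Input → α → Prop} [∀ I a, Decidable (P I a)] {F G : Input → α → ℕ}
    (hP : CompP P) (hF : Comp F) (hG : Comp G) :
    Comp (fun I a => if P I a then F I a else G I a) := by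
  have : (fun I a => if P I a then F I a else G I a) =
      fun I a => if ind (P I a) ≠ 0 then F I a else G I a := by
    funext I a
    by_cases h : P I a <;> simp [ind, h]
  rw [this]
  exact Comp.cond hP hF hG

theorem CompP.ne_zero {F : Input → α → ℕ} (hF : Comp F) : CompP (fun I a => F I a ≠ 0) := by
  have : (fun I a => ind (F I a ≠ 0)) = fun I a => if F I a ≠ 0 then 1 else 0 := by
    funext I a
    by_cases h : F I a = 0 <;> simp [ind, h]
  rw [CompP, this]
  exact hF.cond (.const 1) (.const 0)

theorem CompP.weak {P : Input → α → Prop} (hP : CompP P) : CompP (fun I (a : α × β) => P I a.1) :=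
  Comp.weak (F := fun I a => ind (P I a)) hP

theorem CompP.not {P : Input → α → Prop} (hP : CompP P) : CompP (fun I a => ¬P I a) :=
  (CompP.ne_zero (Comp.sub (.const 1) hP)).of_iff fun I a => by
    by_cases h : P I a <;> simp [ind, h]

theorem CompP.or {P Q : Input → α → Prop} (hP : CompP P) (hQ : CompP Q) :
    CompP (fun I a => P I a ∨ Q I a) :=
  (CompP.ne_zero (Comp.add hP hQ)).of_iff fun I a => by
    by_cases h : P I a <;> by_cases h' : Q I a <;> simp [ind, h, h']

theorem CompP.and {P Q : Input → α → Prop} (hP : CompP P) (hQ : CompP Q) :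
    CompP (fun I a => P I a ∧ Q I a) :=
  (hP.not.or hQ.not).not.of_iff fun I a => by tauto

theorem CompP.imp {P Q : Input → α → Prop} (hP : CompP P) (hQ : CompP Q) :
    CompP (fun I a => P I a → Q I a) :=
  (hP.not.or hQ).of_iff fun I a => by tauto

theorem CompP.lt {F G : Input → α → ℕ} (hF : Comp F) (hG : Comp G) :
    CompP (fun I a => F I a < G I a) :=
  (CompP.ne_zero (hG.sub hF)).of_iff fun I a => by omega

theorem CompP.le {F G : Input → α → ℕ} (hF : Comp F) (hG : Comp G) :
    CompP (fun I a => F I a ≤ G I a) :=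
  (CompP.lt hG hF).not.of_iff fun I a => by omega

theorem CompP.eq {F G : Input → α → ℕ} (hF : Comp F) (hG : Comp G) :
    CompP (fun I a => F I a = G I a) :=
  ((CompP.le hF hG).and (CompP.le hG hF)).of_iff fun I a => by omega

theorem CompP.ex {P : Input → α → ℕ → Prop} {G : Input → α → ℕ} (hG : Comp G)
    (hP : CompP (fun I (a : α × ℕ) => P I a.1 a.2)) :
    CompP (fun I a => ∃ i < G I a, P I a i) := by
  let H : Input → (α × ℕ) × ℕ → ℕ := fun I a => ind (a.2 ≠ 0 ∨ P I a.1.1 a.1.2)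
  have hH : Comp H := CompP.or (CompP.ne_zero Comp.last)
    (CompP.weak (P := fun I (a : α × ℕ) => P I a.1 a.2) hP)
  have key : ∀ I a j, acc (fun _ (_ : α) => 0) H I a j = ind (∃ i < j, P I a i) := by
    intro I a j
    induction j with
    | zero => simp [acc, ind]
    | succ j ih =>
      simp only [acc, H, ih, ind_ne_zero]
      congr 1
      refine propext ⟨?_, ?_⟩
      · rintro (⟨i, hi, h⟩ | h)
        · exact ⟨i, by omega, h⟩
        · exact ⟨j, by omega, h⟩
      · rintro ⟨i, hi, h⟩
        rcases Nat.lt_succ_iff_lt_or_eq.1 hi with hi | rfl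
        · exact .inl ⟨i, hi, h⟩
        · exact .inr h
  have := Comp.fold (.const 0) hG hH ((PolyB.const 1).mono fun I a => by
    rw [key]
    exact ind_le_one _)
  simp only [key] at this
  exact this

theorem CompP.all {P : Input → α → ℕ → Prop} {G : Input → α → ℕ} (hG : Comp G)
    (hP : CompP (fun I (a : α × ℕ) => P I a.1 a.2)) :
    CompP (fun I a => ∀ i < G I a, P I a i) :=
  (CompP.ex (P := fun I a i => ¬P I a i) hG hP.not).not.of_iff fun I a => by
    push Not
    rfl

theorem Comp.mul {F G : Input → α → ℕ} (hF : Comp F) (hG : Comp G) :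
    Comp (fun I a => F I a * G I a) := by
  let H : Input → (α × ℕ) × ℕ → ℕ := fun I a => a.2 + F I a.1.1
  have hH : Comp H := Comp.last.add hF.weak.weak
  have key : ∀ I a j, acc (fun _ (_ : α) => 0) H I a j = F I a * j := by
    intro I a j
    induction j with
    | zero => rfl
    | succ j ih => simp only [acc, H, ih]; ring
  have := Comp.fold (.const 0) hG hH (by
    simp only [key]
    exact hF.weak.1.mul Comp.last.1)
  simp only [key] at this
  exact this

theorem Comp.div {F G : Input → α → ℕ} (hF : Comp F) (hG : Comp G) :
    Comp (fun I a => F I a / G I a) := by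
  let H : Input → (α × ℕ) × ℕ → ℕ :=
    fun I a => a.2 + ind (G I a.1.1 ≠ 0 ∧ (a.1.2 + 1) * G I a.1.1 ≤ F I a.1.1)
  have hH : Comp H := Comp.last.add (CompP.and (CompP.ne_zero hG.weak.weak)
    (CompP.le ((Comp.last.weak.add (.const 1)).mul hG.weak.weak) hF.weak.weak))
  have key : ∀ I a j, acc (fun _ (_ : α) => 0) H I a j = min j (F I a / G I a) := by
    intro I a j
    induction j with
    | zero => simp [acc]
    | succ j ih =>
      simp only [acc, H, ih]
      rcases Nat.eq_zero_or_pos (G I a) with h0 | h0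
      · simp [h0, ind]
      · rw [← Nat.le_div_iff_mul_le h0]
        by_cases h : j + 1 ≤ F I a / G I a
        · rw [ind_of ⟨h0.ne', h⟩]; omega
        · rw [ind_of_not (fun h' => h h'.2)]; omega
  have := Comp.fold (.const 0) hF hH (by
    simp only [key]
    exact Comp.last.1.mono fun _ _ => min_le_left _ _)
  simp only [key, min_eq_right (Nat.div_le_self _ _)] at this
  exact this

theorem Comp.mod {F G : Input → α → ℕ} (hF : Comp F) (hG : Comp G) :
    Comp (fun I a => F I a % G I a) := by
  simp only [Nat.mod_eq_sub]
  exact hF.sub (hG.mul (hF.div hG))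

theorem Comp.pow {F : Input → α → ℕ} (hF : Comp F) : ∀ k : ℕ, Comp (fun I a => F I a ^ k)
  | 0 => by simpa using Comp.const 1
  | k + 1 => by simpa [pow_succ] using (hF.pow k).mul hF

/-- The digit of index `m` of `y` in base `D`. -/
def dig (D y m : ℕ) : ℕ := y / D ^ m % D

theorem Comp.dig {F G H : Input → α → ℕ} (hF : Comp F) (hG : Comp G) (hH : Comp H) :
    Comp (fun I a => dig (F I a) (G I a) (H I a)) := by
  let K : Input → (α × ℕ) × ℕ → ℕ := fun I a => a.2 / F I a.1.1
  have hK : Comp K := Comp.last.div hF.weak.weak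
  have key : ∀ I a j, acc G K I a j = G I a / F I a ^ j := by
    intro I a j
    induction j with
    | zero => simp [acc]
    | succ j ih => simp only [acc, K, ih, pow_succ, Nat.div_div_eq_div_mul]
  have := Comp.fold hG hH hK (by
    simp only [key]
    exact hG.weak.1.mono fun _ _ => Nat.div_le_self _ _)
  simp only [key] at this
  exact this.mod hF

/-- Words that can be appended to the output in polynomial time. -/
def Emit (L : Input → α → List ℕ) : Prop :=
  ∃ T : Input → α → ℕ, PolyB T ∧ ∀ (A m : ℕ) (rd : (ℕ → ℕ) → α), Good m rd →
    ∃ p, ∀ (I : Input) (σ : State), σ.arr A = I.data → ∃ τ t, Runs p σ τ t ∧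
      τ.out = σ.out ++ L I (rd σ.var) ∧ (∀ x < m, τ.var x = σ.var x) ∧ τ.arr = σ.arr ∧
      t ≤ T I (rd σ.var)

theorem Comp.emit {F : Input → α → ℕ} (hF : Comp F) : Emit (fun I a => [F I a]) := by
  obtain ⟨-, T, hT, hF⟩ := hF
  refine ⟨fun I a => T I a + 2, hT.add (.const 2), fun A m rd hg => ?_⟩
  obtain ⟨p, hp⟩ := hF A m rd hg
  refine ⟨.seq p (.write (.var m)), fun I σ hσ => ?_⟩
  obtain ⟨τ, t, hr, h1, h2, h3, h4, h5⟩ := hp I σ hσ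
  refine ⟨_, _, hr.seq (.write _ _), ?_, h2, h3, ?_⟩
  · simp [State.append, Expr.eval, h1, h4]
  · simp only [Expr.cost]; omega

theorem Emit.append {L L' : Input → α → List ℕ} (hL : Emit L) (hL' : Emit L') :
    Emit (fun I a => L I a ++ L' I a) := by
  obtain ⟨T, hT, hL⟩ := hL
  obtain ⟨S, hS, hL'⟩ := hL'
  refine ⟨fun I a => T I a + S I a, hT.add hS, fun A m rd hg => ?_⟩
  obtain ⟨p, hp⟩ := hL A m rd hg
  obtain ⟨q, hq⟩ := hL' A m rd hg
  refine ⟨.seq p q, fun I σ hσ => ?_⟩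
  obtain ⟨τ, t, hr, h1, h2, h3, h4⟩ := hp I σ hσ
  obtain ⟨υ, s, hr', g1, g2, g3, g4⟩ := hq I τ (by rw [h3, hσ])
  rw [stable hg h2] at g1 g4
  exact ⟨υ, _, hr.seq hr', by rw [g1, h1, List.append_assoc],
    fun x hx => (g2 x hx).trans (h2 x hx), g3.trans h3, Nat.add_le_add h4 g4⟩

theorem Comp.emit_range {F : Input → α → ℕ → ℕ} {G : Input → α → ℕ} (hG : Comp G)
    (hF : Comp (fun I (a : α × ℕ) => F I a.1 a.2)) :
    Emit (fun I a => (List.range (G I a)).map (F I a)) := by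
  obtain ⟨hBG, S, hS, hG⟩ := hG
  obtain ⟨-, U, ⟨c, hU⟩, hF⟩ := hF
  have hV : PolyB (fun I (a : α) => (I.size + wt (a, G I a) + 2) ^ c) :=
    PolyB.comp (f := fun I (b : α × ℕ) => (I.size + Ctx.wt b + 2) ^ c)
      ⟨c, fun _ _ => le_rfl⟩ (PolyB.wt.add hBG)
  refine ⟨fun I a => S I a + 6 + G I a * ((I.size + wt (a, G I a) + 2) ^ c + 10),
    (hS.add (.const 6)).add (hBG.mul (hV.add (.const 10))), fun A m rd hg => ?_⟩
  obtain ⟨q, hq⟩ := hG A m rd hg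
  obtain ⟨u, hu⟩ := hF A (m + 2) _ (Good.push (m' := m + 2) (x := m + 1) hg (by omega) (by omega))
  refine ⟨.seq q (.seq (.assign (m + 1) (.lit 0)) (.while (.sub (.var m) (.var (m + 1)))
    (.seq u (.seq (.write (.var (m + 2)))
      (.assign (m + 1) (.add (.var (m + 1)) (.lit 1))))))), fun I σ hσ => ?_⟩
  obtain ⟨υ, s, hr', g1, g2, g3, g4, g5⟩ := hq I σ hσ
  set a := rd σ.var with ha
  set g := G I a with hgdef
  set V := (I.size + wt (a, g) + 2) ^ c with hVdef
  have loop : ∀ (r i : ℕ) (ρ : State), i + r = g → ρ.arr A = I.data → rd ρ.var = a →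
      ρ.var m = g → ρ.var (m + 1) = i → ρ.out = σ.out ++ (List.range i).map (F I a) →
      ∃ ρ' t, Runs (.while (.sub (.var m) (.var (m + 1)))
        (.seq u (.seq (.write (.var (m + 2)))
          (.assign (m + 1) (.add (.var (m + 1)) (.lit 1)))))) ρ ρ' t ∧
        ρ'.out = σ.out ++ (List.range g).map (F I a) ∧ (∀ x < m, ρ'.var x = ρ.var x) ∧
        ρ'.arr = ρ.arr ∧ t ≤ 4 + r * (V + 10) := by
    intro r
    induction r with
    | zero =>
      intro i ρ hi k1 k2 k3 k4 k5
      refine ⟨_, _, .while_false ?_, ?_, fun _ _ => rfl, rfl, by simp [Expr.cost]⟩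
      · simp only [Expr.eval]; omega
      · rw [k5, ← hi, add_zero]
    | succ r ih =>
      intro i ρ hi k1 k2 k3 k4 k5
      obtain ⟨τ', t', l0, l1, l2, l3, l4, l5⟩ := hu I ρ k1
      dsimp only at l1 l5
      rw [k2, k4] at l1 l5
      set ρ' := (τ'.append (τ'.var (m + 2))).setVar (m + 1) (i + 1) with hρ'
      have lr : ∀ x < m, ρ'.var x = ρ.var x := by
        intro x hx
        rw [← l2 x (by omega)]
        simp [hρ', State.setVar, State.append, show x ≠ m + 1 by omega]
      obtain ⟨ρ₁, t₁, n0, n1, n2, n3, n4⟩ := ih (i + 1) ρ' (by omega)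
        (by simp [hρ', State.setVar, State.append, l3, k1]) (by rw [← k2]; exact stable hg lr)
        (by simp [hρ', State.setVar, State.append, l2 m, k3])
        (by simp [hρ', State.setVar]) (by
          simp [hρ', State.setVar, State.append, l4, l1, k5, List.range_succ])
      have run : Runs (.seq u (.seq (.write (.var (m + 2)))
          (.assign (m + 1) (.add (.var (m + 1)) (.lit 1))))) ρ ρ' (t' + (2 + 4)) := by
        have := Runs.seq l0 (.seq (.write (.var (m + 2)) τ')
          (.assign (m + 1) (.add (.var (m + 1)) (.lit 1)) _))
        simpa [Expr.eval, Expr.cost, State.setVar, State.append, hρ', l2 (m + 1), k4] using this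
      refine ⟨ρ₁, _, .while_true (by simp only [Expr.eval]; omega) run n0, n1,
        fun x hx => (n2 x hx).trans (lr x hx),
        n3.trans (by simp [hρ', State.setVar, State.append, l3]), ?_⟩
      have : t' ≤ V := by
        refine l5.trans ((hU _ _).trans (Nat.pow_le_pow_left ?_ c))
        simp only [wt_pair, wt_nat]
        omega
      simp only [Expr.cost, add_mul]; omega
  obtain ⟨ρ, w, n0, n1, n2, n3, n4⟩ := loop g 0 (υ.setVar (m + 1) 0) (by omega)
    (by simp [State.setVar, g3, hσ])
    (stable hg fun x hx => by
      simp only [State.setVar, Function.update_of_ne (show x ≠ m + 1 by omega), g2 x hx])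
    (by simp [State.setVar, g1]) (by simp [State.setVar]) (by simp [State.setVar, g4])
  refine ⟨ρ, _, hr'.seq (.seq (.assign _ _ _) n0), n1, fun x hx => ?_, n3.trans g3, ?_⟩
  · rw [n2 x hx, ← g2 x hx]
    simp [State.setVar, show x ≠ m + 1 by omega]
  · change _ ≤ S I a + 6 + g * (V + 10)
    simp only [Expr.cost]; omega

end RAM

/-! ### Redirecting the output of a program into an array -/

namespace RAM

/-- All register and array names in the expression are below `N`. -/
def Expr.Below (N : ℕ) : Expr → Prop
  | .lit _ => True
  | .var x => x < N
  | .get a i => a < N ∧ i.Below N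
  | .add e₁ e₂ => e₁.Below N ∧ e₂.Below N
  | .sub e₁ e₂ => e₁.Below N ∧ e₂.Below N

/-- All register and array names in the program are below `N`. -/
def Prog.Below (N : ℕ) : Prog → Prop
  | .skip => True
  | .assign x e => x < N ∧ e.Below N
  | .store a i e => a < N ∧ i.Below N ∧ e.Below N
  | .write e => e.Below N
  | .seq p q => p.Below N ∧ q.Below N
  | .ite e p q => e.Below N ∧ p.Below N ∧ q.Below N
  | .while e p => e.Below N ∧ p.Below N

theorem Expr.eventually_below (e : Expr) : ∀ᶠ N in Filter.atTop, e.Below N := by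
  induction e with
  | lit c => simp [Expr.Below]
  | var x => exact Filter.eventually_gt_atTop x
  | get a i ih => exact (Filter.eventually_gt_atTop a).and ih
  | add _ _ ih₁ ih₂ => exact ih₁.and ih₂
  | sub _ _ ih₁ ih₂ => exact ih₁.and ih₂

theorem Prog.eventually_below (p : Prog) : ∀ᶠ N in Filter.atTop, p.Below N := by
  induction p with
  | skip => simp [Prog.Below]
  | assign x e => exact (Filter.eventually_gt_atTop x).and e.eventually_below
  | store a i e =>
    exact (Filter.eventually_gt_atTop a).and (i.eventually_below.and e.eventually_below)
  | write e => exact e.eventually_below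
  | seq p q ihp ihq => exact ihp.and ihq
  | ite e p q ihp ihq => exact e.eventually_below.and (ihp.and ihq)
  | _ e p ih => exact e.eventually_below.and ih

/-- The program that stores in array `N` what `p` writes on the output tape, and counts in
register `N`. -/
def Prog.divert (N : ℕ) : Prog → Prog
  | .skip => .skip
  | .assign x e => .assign x e
  | .store a i e => .store a i e
  | .write e => .seq (.store N (.var N) e) (.assign N (.add (.var N) (.lit 1)))
  | .seq p q => .seq (p.divert N) (q.divert N)
  | .ite e p q => .ite e (p.divert N) (q.divert N)
  | .while e p => .while e (p.divert N)

/-- `σ'` agrees with `σ` below `N` and holds the output of `σ` in array `N`. -/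
structure Mirror (N : ℕ) (σ σ' : State) : Prop where
  var : ∀ x < N, σ'.var x = σ.var x
  arr : ∀ a < N, σ'.arr a = σ.arr a
  count : σ'.var N = σ.out.length
  tape : σ'.arr N = fun i => σ.out.getD i 0
  out : σ'.out = []

theorem Expr.eval_mirror {N : ℕ} {σ σ' : State} (h : Mirror N σ σ') {e : Expr} (he : e.Below N) :
    e.eval σ' = e.eval σ := by
  induction e with
  | lit c => rfl
  | var x => exact h.var x he
  | get a i ih => simp only [Expr.eval, ih he.2, h.arr a he.1]
  | add _ _ ih₁ ih₂ => simp only [Expr.eval, ih₁ he.1, ih₂ he.2]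
  | sub _ _ ih₁ ih₂ => simp only [Expr.eval, ih₁ he.1, ih₂ he.2]

theorem Runs.divert {N : ℕ} {p : Prog} {σ τ : State} {t : ℕ} (h : Runs p σ τ t) :
    p.Below N → ∀ {σ' : State}, Mirror N σ σ' →
      ∃ τ' t', Runs (p.divert N) σ' τ' t' ∧ Mirror N τ τ' ∧ t' ≤ 6 * t := by
  induction h with
  | skip σ => exact fun _ σ' h => ⟨σ', 1, .skip _, h, by omega⟩
  | assign x e σ =>
    intro hp σ' h
    refine ⟨_, _, .assign _ _ _, ⟨fun y hy => ?_, h.arr, ?_, h.tape, h.out⟩, by omega⟩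
    · rw [Expr.eval_mirror h hp.2]
      by_cases hxy : y = x
      · simp [State.setVar, hxy]
      · simp [State.setVar, hxy, h.var y hy]
    · simp [State.setVar, hp.1.ne', h.count]
  | store a i e σ =>
    intro hp σ' h
    refine ⟨_, _, .store _ _ _ _, ⟨h.var, fun b hb => ?_, h.count, ?_, h.out⟩, by omega⟩
    · rw [Expr.eval_mirror h hp.2.1, Expr.eval_mirror h hp.2.2]
      by_cases hab : b = a
      · subst hab
        simp [State.setArr, h.arr b hb]
      · simp [State.setArr, hab, h.arr b hb]
    · simp [State.setArr, hp.1.ne', h.tape]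
  | write e σ =>
    intro hp σ' h
    refine ⟨_, _, .seq (.store _ _ _ _) (.assign _ _ _),
      ⟨fun y hy => ?_, fun b hb => ?_, ?_, ?_, h.out⟩, ?_⟩
    · simp [State.setVar, State.setArr, State.append, hy.ne, h.var y hy]
    · simp [State.setVar, State.setArr, State.append, hb.ne, h.arr b hb]
    · simp [State.setVar, State.setArr, State.append, Expr.eval, h.count]
    · funext i
      simp only [State.setVar, State.setArr, State.append, Expr.eval, Function.update_self, h.count,
        h.tape, Expr.eval_mirror h hp]
      rcases lt_trichotomy i σ.out.length with hi | rfl | hi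
      · rw [Function.update_of_ne hi.ne, List.getD_append _ _ _ _ hi]
      · simp
      · rw [Function.update_of_ne hi.ne', List.getD_eq_default _ _ hi.le,
          List.getD_eq_default _ _ (by simp; omega)]
    · simp only [Expr.cost]; omega
  | seq _ _ ihp ihq =>
    intro hp σ' h
    obtain ⟨τ', t', r, hm, ht⟩ := ihp hp.1 h
    obtain ⟨υ', s', r', hm', ht'⟩ := ihq hp.2 hm
    exact ⟨υ', _, r.seq r', hm', by omega⟩
  | ite_true he _ ih =>
    intro hp σ' h
    obtain ⟨τ', t', r, hm, ht⟩ := ih hp.2.1 h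
    exact ⟨τ', _, .ite_true (by rwa [Expr.eval_mirror h hp.1]) r, hm, by omega⟩
  | ite_false he _ ih =>
    intro hp σ' h
    obtain ⟨τ', t', r, hm, ht⟩ := ih hp.2.2 h
    exact ⟨τ', _, .ite_false (by rwa [Expr.eval_mirror h hp.1]) r, hm, by omega⟩
  | while_true he _ _ ihp ihq =>
    intro hp σ' h
    obtain ⟨τ', t', r, hm, ht⟩ := ihp hp.2 h
    obtain ⟨υ', s', r', hm', ht'⟩ := ihq hp hm
    exact ⟨υ', _, .while_true (by rwa [Expr.eval_mirror h hp.1]) r r', hm', by omega⟩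
  | while_false he =>
    intro hp σ' h
    exact ⟨σ', _, .while_false (by rwa [Expr.eval_mirror h hp.1]), h, by omega⟩

theorem mirror_init {N : ℕ} (hN : 0 < N) (w : List ℕ) :
    Mirror N (State.init w) (State.init w) where
  var _ _ := rfl
  arr _ _ := rfl
  count := by simp [State.init, hN.ne']
  tape := by simp [State.init, hN.ne']
  out := rfl

theorem Runs.length_out {p : Prog} {σ τ : State} {t : ℕ} (h : Runs p σ τ t) :
    τ.out.length ≤ σ.out.length + t := by
  induction h with
  | write e σ => simp [State.append]
  | seq _ _ ih₁ ih₂ => omega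
  | while_true _ _ _ ih₁ ih₂ => omega
  | _ => first | omega | simp [State.setVar, State.setArr]

end RAM

/-! ### Steiner networks on numbered vertices -/

namespace Steiner

/-- A network for the pattern `pat` on the vertices below `T` in the graph on the vertices below
`V`, of cost at most `b`. The weights are coded as in `Instance.encode`. -/
def HasNetwork (V T : ℕ) (W : ℕ → ℕ → ℕ) (pat : ℕ → ℕ → Prop) (b : ℕ) : Prop :=
  ∃ N : Finset (ℕ × ℕ), (∀ e ∈ N, e.1 < V ∧ e.2 < V ∧ W e.1 e.2 ≠ 0) ∧
    (∀ s < T, ∀ t < T, pat s t → Relation.ReflTransGen (fun u v => (u, v) ∈ N) s t) ∧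
    ∑ e ∈ N, (W e.1 e.2 - 1) ≤ b

theorem HasNetwork.swap {V T : ℕ} {W : ℕ → ℕ → ℕ} {pat : ℕ → ℕ → Prop} {b : ℕ}
    (h : HasNetwork V T W pat b) :
    HasNetwork V T (fun u v => W v u) (fun s t => pat t s) b := by
  obtain ⟨N, h1, h2, h3⟩ := h
  refine ⟨N.map (Equiv.prodComm ℕ ℕ).toEmbedding, ?_, fun s hs t ht hst => ?_, ?_⟩
  · rintro ⟨u, v⟩ he
    obtain ⟨⟨v', u'⟩, he', heq⟩ := Finset.mem_map.1 he
    simp only [Equiv.coe_toEmbedding, Equiv.prodComm_apply, Prod.swap_prod_mk,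
      Prod.mk.injEq] at heq
    obtain ⟨rfl, rfl⟩ := heq
    obtain ⟨k1, k2, k3⟩ := h1 _ he'
    exact ⟨k2, k1, k3⟩
  · refine (Relation.reflTransGen_swap.2 (h2 t ht s hs hst)).lift id fun u v huv => ?_
    exact Finset.mem_map.2 ⟨(v, u), huv, rfl⟩
  · simpa using h3

/-- The instance with vertices below `V`, weights coded by `W` and the terminals below `T`. -/
def codeInstance (𝓗 : PatternClass) (V T : ℕ) (W : ℕ → ℕ → ℕ) (pat : ℕ → ℕ → Prop) (b : ℕ)
    (h : 𝓗 (Finset.univ.filter fun v : Fin V => v.val < T)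
      ⟨fun s t => pat s.val.val t.val.val⟩) : Instance 𝓗 where
  n := V
  weight u v := if W u v = 0 then none else some (W u v - 1)
  terminals := Finset.univ.filter fun v : Fin V => v.val < T
  pattern := ⟨fun s t => pat s.val.val t.val.val⟩
  pattern_mem := h
  budget := b

theorem codeInstance_yes {𝓗 : PatternClass} {V T : ℕ} {W : ℕ → ℕ → ℕ} {pat : ℕ → ℕ → Prop} {b : ℕ}
    (hT : T ≤ V) (h) :
    (DSN 𝓗).yes (codeInstance 𝓗 V T W pat b h) ↔ HasNetwork V T W pat b := by
  change (∃ N : Finset (Fin V × Fin V),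
    ((∀ e ∈ N, (if W e.1 e.2 = 0 then none else some (W e.1 e.2 - 1)).isSome) ∧
      ∀ s t : (Finset.univ.filter fun v : Fin V => v.val < T), pat s.val.val t.val.val →
        Relation.ReflTransGen (fun u v => (u, v) ∈ N) s.val t.val) ∧
      ∑ e ∈ N, (if W e.1 e.2 = 0 then none else some (W e.1 e.2 - 1)).getD 0 ≤ b) ↔ _
  have hw : ∀ u v : Fin V, (if W u v = 0 then none else some (W u v - 1)).getD 0 = W u v - 1 := by
    intro u v
    by_cases h0 : W u v = 0 <;> simp [h0]
  have hs : ∀ u v : Fin V, (if W u v = 0 then none else some (W u v - 1)).isSome ↔ W u v ≠ 0 := by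
    intro u v
    by_cases h0 : W u v = 0 <;> simp [h0]
  let ι : Fin V × Fin V ↪ ℕ × ℕ := Fin.valEmbedding.prodMap Fin.valEmbedding
  constructor
  · rintro ⟨N, ⟨h1, h2⟩, h3⟩
    refine ⟨Finset.map ι N, ?_, fun s hs t ht hst => ?_, ?_⟩
    · rintro e he'
      obtain ⟨⟨u, v⟩, he, rfl⟩ := Finset.mem_map.1 he'
      exact ⟨u.2, v.2, (hs u v).1 (h1 (u, v) he)⟩
    · have := h2 ⟨⟨s, by omega⟩, by simpa using hs⟩ ⟨⟨t, by omega⟩, by simpa using ht⟩ hst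
      refine this.lift (fun v : Fin V => v.val) fun u v huv => ?_
      exact Finset.mem_map.2 ⟨(u, v), huv, rfl⟩
    · rw [Finset.sum_map]
      exact le_trans (le_of_eq (Finset.sum_congr rfl fun e _ => (hw e.1 e.2).symm)) h3
  · rintro ⟨N, h1, h2, h3⟩
    classical
    let N' : Finset (Fin V × Fin V) := Finset.univ.filter fun e => (e.1.val, e.2.val) ∈ N
    refine ⟨N', ⟨fun e he => ?_, fun s t hst => ?_⟩, ?_⟩
    · exact (hs e.1 e.2).2 (h1 _ (Finset.mem_filter.1 he).2).2.2
    · have hmem : ∀ r : (Finset.univ.filter fun v : Fin V => v.val < T), r.val.val < T := fun r =>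
        (Finset.mem_filter.1 r.2).2
      have key : ∀ t : ℕ, Relation.ReflTransGen (fun u v => (u, v) ∈ N) s.val.val t →
          ∃ t' : Fin V, t'.val = t ∧
            Relation.ReflTransGen (fun u v : Fin V => (u, v) ∈ N') s.val t' := by
        intro t ht
        induction ht with
        | refl => exact ⟨s.val, rfl, .refl⟩
        | tail _ huv ih =>
          obtain ⟨u, rfl, hu⟩ := ih
          exact ⟨⟨_, (h1 _ huv).2.1⟩, rfl, hu.tail (by simpa [N'] using huv)⟩
      obtain ⟨t', ht', hr⟩ := key _ (h2 _ (hmem s) _ (hmem t) hst)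
      rwa [Fin.ext ht'] at hr
    · calc _ = ∑ e ∈ Finset.map ι N', (W e.1 e.2 - 1) := by
            rw [Finset.sum_map]
            exact Finset.sum_congr rfl fun e _ => hw e.1 e.2
        _ ≤ ∑ e ∈ N, (W e.1 e.2 - 1) := by
            refine Finset.sum_le_sum_of_subset fun e he' => ?_
            obtain ⟨e, he, rfl⟩ := Finset.mem_map.1 he'
            exact (Finset.mem_filter.1 he).2
        _ ≤ b := h3

theorem card_terminals {V T : ℕ} (hT : T ≤ V) :
    (Finset.univ.filter fun v : Fin V => v.val < T).card = T := by
  rw [Fin.card_filter_val_lt, min_eq_right hT]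

theorem isPureOutDiamond_code {V T : ℕ} (hT : T ≤ V) (h2 : 2 < T) :
    pureOutDiamonds (Finset.univ.filter fun v : Fin V => v.val < T)
      ⟨fun s t => s.val.val < 2 ∧ 2 ≤ t.val.val⟩ := by
  classical
  let S : Finset (Fin V) := Finset.univ.filter fun v => v.val < T
  let L : Finset S := Finset.univ.filter fun v => 2 ≤ v.val.val
  have hmem : ∀ i (hi : i < T), (⟨i, by omega⟩ : Fin V) ∈ S := fun i hi => by simpa [S] using hi
  refine ⟨L.card, Finset.card_pos.2 ⟨⟨⟨2, by omega⟩, hmem 2 h2⟩, by simp [L]⟩,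
    ⟨⟨0, by omega⟩, hmem 0 (by omega)⟩, ⟨⟨1, by omega⟩, hmem 1 (by omega)⟩, L, by simp,
    by simp [L], by simp [L], rfl, fun v => ?_, fun u v => ?_⟩
  · simp only [Subtype.ext_iff, Fin.ext_iff, L, Finset.mem_filter, Finset.mem_univ, true_and]
    omega
  · simp only [Subtype.ext_iff, Fin.ext_iff, L, Finset.mem_filter, Finset.mem_univ, true_and]
    omega

theorem isPureInDiamond_code {V T : ℕ} (hT : T ≤ V) (h2 : 2 < T) :
    pureInDiamonds (Finset.univ.filter fun v : Fin V => v.val < T)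
      ⟨fun s t => t.val.val < 2 ∧ 2 ≤ s.val.val⟩ := by
  obtain ⟨α, h1, r₁, r₂, L, k1, k2, k3, k4, k5, k6⟩ := isPureOutDiamond_code hT h2
  exact ⟨α, h1, r₁, r₂, L, k1, k2, k3, k4, k5, fun u v => (k6 v u).trans and_comm⟩

theorem ofFn_eq_map_range {n : ℕ} (f : ℕ → ℕ) :
    List.ofFn (fun i : Fin n => f i) = (List.range n).map f := by
  apply List.ext_getElem <;> simp

theorem codeInstance_encode {𝓗 : PatternClass} {V T : ℕ} {W : ℕ → ℕ → ℕ} {pat : ℕ → ℕ → Prop}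
    {b : ℕ} (h) :
    (codeInstance 𝓗 V T W pat b h).encode = V :: b ::
      ((List.range V).map (fun v => RAM.ind (v < T)) ++
      ((List.range (V * V)).map (fun i => W (i / V) (i % V)) ++
      (List.range (V * V)).map fun i =>
        RAM.ind (i / V < T ∧ i % V < T ∧ pat (i / V) (i % V)))) := by
  have hm : ∀ v : Fin V, v ∈ (codeInstance 𝓗 V T W pat b h).terminals ↔ v.val < T := fun v => by
    change v ∈ Finset.univ.filter (fun v : Fin V => v.val < T) ↔ _
    simp
  rw [Instance.encode]
  refine congrArg₂ _ rfl (congrArg₂ _ rfl (congrArg₂ _ ?_ (congrArg₂ _ ?_ ?_)))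
  · rw [← ofFn_eq_map_range]
    refine congrArg _ (funext fun (v : Fin V) => @if_congr _ _ _ (_) (_) _ _ _ _ (hm v) rfl rfl)
  · rw [← ofFn_eq_map_range, matrixWord]
    refine congrArg _ (funext fun (i : Fin (V * V)) => ?_)
    by_cases h0 : W (i / V) (i % V) = 0
    · simp [codeInstance, h0]
    · simp [codeInstance, h0]; omega
  · rw [← ofFn_eq_map_range, matrixWord]
    refine congrArg _ (funext fun (i : Fin (V * V)) => @if_congr _ _ _ (_) (_) _ _ _ _ ⟨?_, ?_⟩ rfl rfl)
    · rintro ⟨hu, hv, hp⟩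
      exact ⟨(hm _).1 hu, (hm _).1 hv, hp⟩
    · rintro ⟨hu, hv, hp⟩
      exact ⟨(hm i.divNat).2 hu, (hm i.modNat).2 hv, hp⟩

end Steiner

/-! ### Constraint systems as Steiner networks of two out-stars -/

namespace Steiner.Gadget

open RAM (dig ind)

/-- Number of leaves. -/
def leaves (A M : ℕ) : ℕ := A ^ M * M

def mid (A M D j x : ℕ) : ℕ := 2 + leaves A M + (j * D + x)

def left (A M D a x : ℕ) : ℕ := 2 + leaves A M + leaves A M * D + (a * D + x)

def right (A M D b y : ℕ) : ℕ := 2 + leaves A M + leaves A M * D + A * D + (b * D ^ M + y)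

def order (A M D : ℕ) : ℕ := 2 + leaves A M + leaves A M * D + A * D + A ^ M * D ^ M

/-- The arcs of weight one: from the first root to the values of the variables, from the second
root to the admissible tuples of values of the tuples of variables, and to the leaves. -/
def Heavy (A M D : ℕ) (φ : ℕ → ℕ → Prop) (u v : ℕ) : Prop :=
  (u = 0 ∧ ∃ a < A, ∃ x < D, v = left A M D a x) ∨
  (u = 1 ∧ ∃ b < A ^ M, ∃ y < D ^ M, v = right A M D b y ∧ φ b y) ∨
  ∃ j < leaves A M, ∃ x < D, u = mid A M D j x ∧ v = 2 + j

/-- The arcs of weight zero: from the values of variables and of tuples to their projections. -/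
def Light (A M D : ℕ) (u v : ℕ) : Prop :=
  ∃ b < A ^ M, ∃ m < M,
    (∃ x < D, u = left A M D (dig A b m) x ∧ v = mid A M D (b * M + m) x) ∨
    ∃ y < D ^ M, u = right A M D b y ∧ v = mid A M D (b * M + m) (dig D y m)

open Classical in
noncomputable def arcs (A M D : ℕ) (φ : ℕ → ℕ → Prop) (u v : ℕ) : ℕ :=
  if Heavy A M D φ u v then 2 else if Light A M D u v then 1 else 0

def pat (s t : ℕ) : Prop := s < 2 ∧ 2 ≤ t

variable {A M D : ℕ} {φ : ℕ → ℕ → Prop}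

theorem code_lt {J D j x : ℕ} (hj : j < J) (hx : x < D) : j * D + x < J * D :=
  calc j * D + x < j * D + D := by omega
    _ = (j + 1) * D := by ring
    _ ≤ J * D := Nat.mul_le_mul_right _ hj

theorem code_inj {D j j' x x' : ℕ} (hx : x < D) (hx' : x' < D) (h : j * D + x = j' * D + x') :
    j = j' ∧ x = x' := by
  have hD : 0 < D := by omega
  have h1 := congrArg (· / D) h
  simp only [mul_comm _ D, Nat.mul_add_div hD, Nat.div_eq_of_lt hx, Nat.div_eq_of_lt hx'] at h1
  obtain rfl : j = j' := by omega
  exact ⟨rfl, by omega⟩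

theorem leaf_lt {b m : ℕ} (hb : b < A ^ M) (hm : m < M) : b * M + m < leaves A M := code_lt hb hm

theorem dig_lt {b m : ℕ} (hb : b < A ^ M) (hm : m < M) : dig A b m < A := by
  refine Nat.mod_lt _ (Nat.pos_of_ne_zero ?_)
  rintro rfl
  simp [show M ≠ 0 by omega] at hb

theorem exists_digits {z : ℕ → ℕ} (hz : ∀ m < M, z m < D) :
    ∃ y < D ^ M, ∀ m < M, dig D y m = z m := by
  let f : Fin M → Fin D := fun m => ⟨z m, hz m m.2⟩
  refine ⟨finFunctionFinEquiv f, (finFunctionFinEquiv f).2, fun m hm => ?_⟩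
  have := congrFun (finFunctionFinEquiv.symm_apply_apply f) ⟨m, hm⟩
  exact congrArg Fin.val this

theorem mid_range {j x : ℕ} (hj : j < leaves A M) (hx : x < D) :
    2 + leaves A M ≤ mid A M D j x ∧ mid A M D j x < 2 + leaves A M + leaves A M * D := by
  have := code_lt hj hx
  unfold mid; omega

theorem left_range {a x : ℕ} (ha : a < A) (hx : x < D) :
    2 + leaves A M + leaves A M * D ≤ left A M D a x ∧
      left A M D a x < 2 + leaves A M + leaves A M * D + A * D := by
  have := code_lt ha hx
  unfold left; omega

theorem right_range {b y : ℕ} (hb : b < A ^ M) (hy : y < D ^ M) :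
    2 + leaves A M + leaves A M * D + A * D ≤ right A M D b y ∧
      right A M D b y < order A M D := by
  have := code_lt hb hy
  unfold right order; omega

theorem mid_inj {j j' x x' : ℕ} (hx : x < D) (hx' : x' < D)
    (h : mid A M D j x = mid A M D j' x') : j = j' ∧ x = x' :=
  code_inj hx hx' (by unfold mid at h; omega)

theorem left_inj {a a' x x' : ℕ} (hx : x < D) (hx' : x' < D)
    (h : left A M D a x = left A M D a' x') : a = a' ∧ x = x' :=
  code_inj hx hx' (by unfold left at h; omega)

theorem right_inj {b b' y y' : ℕ} (hy : y < D ^ M) (hy' : y' < D ^ M)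
    (h : right A M D b y = right A M D b' y') : b = b' ∧ y = y' :=
  code_inj hy hy' (by unfold right at h; omega)

theorem arcs_ne_zero {u v : ℕ} :
    arcs A M D φ u v ≠ 0 ↔ Heavy A M D φ u v ∨ Light A M D u v := by
  unfold arcs
  by_cases h : Heavy A M D φ u v <;> by_cases h' : Light A M D u v <;> simp [h, h']

theorem arcs_sub_one {u v : ℕ} :
    arcs A M D φ u v - 1 = ind (Heavy A M D φ u v) := by
  unfold arcs ind
  by_cases h : Heavy A M D φ u v <;> by_cases h' : Light A M D u v <;> simp [h, h']

theorem arc_target {u v : ℕ} (h : arcs A M D φ u v ≠ 0) : 2 ≤ v := by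
  rcases arcs_ne_zero.1 h with (⟨-, a, ha, x, hx, rfl⟩ | ⟨-, b, hb, y, hy, rfl, -⟩ |
    ⟨j, hj, x, hx, -, rfl⟩) | ⟨b, hb, m, hm, ⟨x, hx, -, rfl⟩ | ⟨y, hy, -, rfl⟩⟩
  · have := left_range (M := M) ha hx; omega
  · have := right_range hb hy; omega
  · omega
  · have := mid_range (leaf_lt hb hm) hx; omega
  · have := mid_range (leaf_lt hb hm) (dig_lt hy hm); omega

theorem arc_to_leaf {u j : ℕ} (hj : j < leaves A M) (h : arcs A M D φ u (2 + j) ≠ 0) :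
    ∃ x < D, u = mid A M D j x := by
  rcases arcs_ne_zero.1 h with (⟨-, a, ha, x, hx, e⟩ | ⟨-, b, hb, y, hy, e, -⟩ |
    ⟨j', hj', x, hx, e', e⟩) | ⟨b, hb, m, hm, ⟨x, hx, -, e⟩ | ⟨y, hy, -, e⟩⟩
  · have := left_range (M := M) ha hx; omega
  · have := right_range hb hy; omega
  · obtain rfl : j = j' := by omega
    exact ⟨x, hx, e'⟩
  · have := mid_range (leaf_lt hb hm) hx; omega
  · have := mid_range (leaf_lt hb hm) (dig_lt hy hm); omega

theorem arc_to_mid {u b m x : ℕ} (hb : b < A ^ M) (hm : m < M) (hx : x < D)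
    (h : arcs A M D φ u (mid A M D (b * M + m) x) ≠ 0) :
    u = left A M D (dig A b m) x ∨ ∃ y < D ^ M, u = right A M D b y ∧ dig D y m = x := by
  have r := mid_range (leaf_lt hb hm) hx
  rcases arcs_ne_zero.1 h with (⟨-, a, ha, x, hx, e⟩ | ⟨-, b, hb, y, hy, e, -⟩ |
    ⟨j', hj', x, hx, e', e⟩) | ⟨b', hb', m', hm', ⟨x', hx', e', e⟩ | ⟨y, hy, e', e⟩⟩
  · have := left_range (M := M) ha hx; omega
  · have := right_range hb hy; omega
  · omega
  · obtain ⟨e1, rfl⟩ := mid_inj hx hx' e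
    obtain ⟨rfl, rfl⟩ := code_inj hm hm' e1
    exact .inl e'
  · obtain ⟨e1, rfl⟩ := mid_inj hx (dig_lt hy hm') e
    obtain ⟨rfl, rfl⟩ := code_inj hm hm' e1
    exact .inr ⟨y, hy, e', rfl⟩

theorem arc_to_left {u a x : ℕ} (ha : a < A) (hx : x < D)
    (h : arcs A M D φ u (left A M D a x) ≠ 0) : u = 0 := by
  have r := left_range (M := M) ha hx
  rcases arcs_ne_zero.1 h with (⟨e, -⟩ | ⟨-, b, hb, y, hy, e, -⟩ |
    ⟨j', hj', x, hx, e', e⟩) | ⟨b', hb', m', hm', ⟨x', hx', e', e⟩ | ⟨y, hy, e', e⟩⟩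
  · exact e
  · have := right_range hb hy; omega
  · omega
  · have := mid_range (leaf_lt hb' hm') hx'; omega
  · have := mid_range (leaf_lt hb' hm') (dig_lt hy hm'); omega

theorem arc_to_right {u b y : ℕ} (hb : b < A ^ M) (hy : y < D ^ M)
    (h : arcs A M D φ u (right A M D b y) ≠ 0) : u = 1 ∧ φ b y := by
  have r := right_range hb hy
  rcases arcs_ne_zero.1 h with (⟨-, a, ha, x, hx, e⟩ | ⟨e', b', hb', y', hy', e, h⟩ |
    ⟨j', hj', x, hx, e', e⟩) | ⟨b', hb', m', hm', ⟨x', hx', e', e⟩ | ⟨y', hy', e', e⟩⟩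
  · have := left_range (M := M) ha hx; omega
  · obtain ⟨rfl, rfl⟩ := right_inj hy hy' e
    exact ⟨e', h⟩
  · omega
  · have := mid_range (leaf_lt hb' hm') hx'; omega
  · have := mid_range (leaf_lt hb' hm') (dig_lt hy' hm'); omega

/-- The shape of the paths from the roots to the leaves. -/
theorem path_to_leaf {N : Finset (ℕ × ℕ)} (hN : ∀ e ∈ N, arcs A M D φ e.1 e.2 ≠ 0) {s b m : ℕ}
    (hs : s < 2) (hb : b < A ^ M) (hm : m < M)
    (h : Relation.ReflTransGen (fun u v => (u, v) ∈ N) s (2 + (b * M + m))) :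
    ∃ x < D, (mid A M D (b * M + m) x, 2 + (b * M + m)) ∈ N ∧
      ((s = 0 ∧ (0, left A M D (dig A b m) x) ∈ N) ∨
        s = 1 ∧ ∃ y < D ^ M, φ b y ∧ (1, right A M D b y) ∈ N ∧ dig D y m = x) := by
  have hj := leaf_lt hb hm
  have root : ∀ r < 2, Relation.ReflTransGen (fun u v => (u, v) ∈ N) s r → s = r := by
    intro r hr h
    rcases h.cases_tail with h | ⟨u, -, h⟩
    · exact h.symm
    · have := arc_target (hN _ h)
      dsimp only at this
      omega
  rcases h.cases_tail with h | ⟨u, h₀, hu⟩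
  · omega
  obtain ⟨x, hx, rfl⟩ := arc_to_leaf hj (hN _ hu)
  refine ⟨x, hx, hu, ?_⟩
  rcases h₀.cases_tail with h | ⟨v, h₁, hv⟩
  · have := mid_range hj hx; omega
  rcases arc_to_mid hb hm hx (hN _ hv) with rfl | ⟨y, hy, rfl, rfl⟩
  · rcases h₁.cases_tail with h | ⟨w, h₂, hw⟩
    · have := left_range (M := M) (dig_lt hb hm) hx; omega
    obtain rfl := arc_to_left (dig_lt hb hm) hx (hN _ hw)
    exact .inl ⟨root 0 (by omega) h₂, hw⟩
  · rcases h₁.cases_tail with h | ⟨w, h₂, hw⟩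
    · have := right_range hb hy; omega
    obtain ⟨rfl, hφ⟩ := arc_to_right hb hy (hN _ hw)
    exact .inr ⟨root 1 (by omega) h₂, y, hy, hφ, hw, rfl⟩

def budget (A M : ℕ) : ℕ := A + A ^ M + leaves A M

theorem solution_of_network (hM : 0 < M)
    (h : HasNetwork (order A M D) (2 + leaves A M) (arcs A M D φ) pat (budget A M)) :
    ∃ x : ℕ → ℕ, (∀ a < A, x a < D) ∧
      ∀ b < A ^ M, ∃ y < D ^ M, φ b y ∧ ∀ m < M, dig D y m = x (dig A b m) := by
  classical
  obtain ⟨N, h1, h2, h3⟩ := h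
  have hN : ∀ e ∈ N, arcs A M D φ e.1 e.2 ≠ 0 := fun e he => (h1 e he).2.2
  have p0 : ∀ b < A ^ M, ∀ m < M, ∃ x < D, (mid A M D (b * M + m) x, 2 + (b * M + m)) ∈ N ∧
      (0, left A M D (dig A b m) x) ∈ N := by
    intro b hb m hm
    have hj := leaf_lt hb hm
    obtain ⟨x, hx, k1, ⟨-, k2⟩ | ⟨k2, -⟩⟩ := path_to_leaf hN (s := 0) (by omega) hb hm
      (h2 0 (by omega) _ (by omega) ⟨by omega, by omega⟩)
    · exact ⟨x, hx, k1, k2⟩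
    · omega
  have p1 : ∀ b < A ^ M, ∀ m < M, ∃ y < D ^ M, φ b y ∧
      (mid A M D (b * M + m) (dig D y m), 2 + (b * M + m)) ∈ N ∧ (1, right A M D b y) ∈ N := by
    intro b hb m hm
    have hj := leaf_lt hb hm
    obtain ⟨x, hx, k1, ⟨k2, -⟩ | ⟨-, y, hy, k2, k3, rfl⟩⟩ := path_to_leaf hN (s := 1) (by omega)
      hb hm (h2 1 (by omega) _ (by omega) ⟨by omega, by omega⟩)
    · omega
    · exact ⟨y, hy, k2, k1, k3⟩
  have eX : ∀ a, ∃ x, a < A → x < D ∧ (0, left A M D a x) ∈ N := by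
    intro a
    by_cases ha : a < A
    · obtain ⟨x, hx, -, k⟩ := p0 a (ha.trans_le (Nat.le_self_pow hM.ne' A)) 0 hM
      rw [dig, pow_zero, Nat.div_one, Nat.mod_eq_of_lt ha] at k
      exact ⟨x, fun _ => ⟨hx, k⟩⟩
    · exact ⟨0, fun h => absurd h ha⟩
  have eY : ∀ b, ∃ y, b < A ^ M → y < D ^ M ∧ φ b y ∧ (1, right A M D b y) ∈ N := by
    intro b
    by_cases hb : b < A ^ M
    · obtain ⟨y, hy, k1, -, k2⟩ := p1 b hb 0 hM
      exact ⟨y, fun _ => ⟨hy, k1, k2⟩⟩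
    · exact ⟨0, fun h => absurd h hb⟩
  have eZ : ∀ j, ∃ x, j < leaves A M → x < D ∧ (mid A M D j x, 2 + j) ∈ N := by
    intro j
    by_cases hj : j < leaves A M
    · obtain ⟨x, hx, k, -⟩ := p0 (j / M) ((Nat.div_lt_iff_lt_mul hM).2 hj) (j % M) (Nat.mod_lt _ hM)
      rw [mul_comm, Nat.div_add_mod] at k
      exact ⟨x, fun _ => ⟨hx, k⟩⟩
    · exact ⟨0, fun h => absurd h hj⟩
  choose X hX using eX
  choose Y hY using eY
  choose Z hZ using eZ
  let S₀ := (Finset.range A).image fun a => (0, left A M D a (X a))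
  let S₁ := (Finset.range (A ^ M)).image fun b => (1, right A M D b (Y b))
  let S₂ := (Finset.range (leaves A M)).image fun j => (mid A M D j (Z j), 2 + j)
  have c0 : S₀.card = A := by
    rw [Finset.card_image_of_injOn, Finset.card_range]
    intro a ha a' ha' e
    simp only [Finset.coe_range, Set.mem_Iio] at ha ha'
    exact (left_inj (hX a ha).1 (hX a' ha').1 (Prod.ext_iff.1 e).2).1
  have c1 : S₁.card = A ^ M := by
    rw [Finset.card_image_of_injOn, Finset.card_range]
    intro a ha a' ha' e
    simp only [Finset.coe_range, Set.mem_Iio] at ha ha'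
    exact (right_inj (hY a ha).1 (hY a' ha').1 (Prod.ext_iff.1 e).2).1
  have c2 : S₂.card = leaves A M := by
    rw [Finset.card_image_of_injOn, Finset.card_range]
    intro a ha a' ha' e
    have := (Prod.ext_iff.1 e).2
    dsimp only at this
    omega
  have f0 : ∀ e ∈ S₀, e.1 = 0 := by
    intro e he
    obtain ⟨a, -, rfl⟩ := Finset.mem_image.1 he
    rfl
  have f1 : ∀ e ∈ S₁, e.1 = 1 := by
    intro e he
    obtain ⟨a, -, rfl⟩ := Finset.mem_image.1 he
    rfl
  have f2 : ∀ e ∈ S₂, 2 ≤ e.1 := by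
    intro e he
    obtain ⟨j, hj, rfl⟩ := Finset.mem_image.1 he
    rw [Finset.mem_range] at hj
    have := mid_range hj (hZ j hj).1
    dsimp only
    omega
  have hcard : (S₀ ∪ S₁ ∪ S₂).card = budget A M := by
    rw [Finset.card_union_of_disjoint, Finset.card_union_of_disjoint, c0, c1, c2, budget]
    · refine Finset.disjoint_left.2 fun e he he' => ?_
      have := f0 e he; have := f1 e he'; omega
    · refine Finset.disjoint_left.2 fun e he he' => ?_
      have := f2 e he'
      rcases Finset.mem_union.1 he with he | he
      · have := f0 e he; omega
      · have := f1 e he; omega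
  let H := N.filter fun e => Heavy A M D φ e.1 e.2
  have hH : H.card ≤ budget A M := by
    refine le_trans (le_of_eq ?_) h3
    rw [Finset.card_filter]
    refine Finset.sum_congr rfl fun e _ => ?_
    rw [arcs_sub_one]
    by_cases h : Heavy A M D φ e.1 e.2 <;> simp [ind, h]
  have hsub : S₀ ∪ S₁ ∪ S₂ ⊆ H := by
    intro e he
    simp only [Finset.mem_union] at he
    rcases he with (he | he) | he
    all_goals
      obtain ⟨a, ha, rfl⟩ := Finset.mem_image.1 he
      rw [Finset.mem_range] at ha
    · exact Finset.mem_filter.2 ⟨(hX a ha).2, .inl ⟨rfl, a, ha, _, (hX a ha).1, rfl⟩⟩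
    · exact Finset.mem_filter.2 ⟨(hY a ha).2.2,
        .inr (.inl ⟨rfl, a, ha, _, (hY a ha).1, rfl, (hY a ha).2.1⟩)⟩
    · exact Finset.mem_filter.2 ⟨(hZ a ha).2, .inr (.inr ⟨a, ha, _, (hZ a ha).1, rfl, rfl⟩)⟩
  have heq := Finset.eq_of_subset_of_card_le hsub (hH.trans hcard.ge)
  have uX : ∀ a < A, ∀ x < D, (0, left A M D a x) ∈ N → x = X a := by
    intro a ha x hx h
    have : (0, left A M D a x) ∈ S₀ ∪ S₁ ∪ S₂ := by
      rw [heq]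
      exact Finset.mem_filter.2 ⟨h, .inl ⟨rfl, a, ha, _, hx, rfl⟩⟩
    simp only [Finset.mem_union] at this
    rcases this with (he | he) | he
    · obtain ⟨a', ha', e⟩ := Finset.mem_image.1 he
      obtain ⟨rfl, e'⟩ := left_inj (hX a' (Finset.mem_range.1 ha')).1 hx (Prod.ext_iff.1 e).2
      exact e'.symm
    · have := f1 _ he; dsimp only at this; omega
    · have := f2 _ he; dsimp only at this; omega
  have uY : ∀ b < A ^ M, ∀ y < D ^ M, φ b y → (1, right A M D b y) ∈ N → y = Y b := by
    intro a ha x hx hφ h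
    have : (1, right A M D a x) ∈ S₀ ∪ S₁ ∪ S₂ := by
      rw [heq]
      exact Finset.mem_filter.2 ⟨h, .inr (.inl ⟨rfl, a, ha, _, hx, rfl, hφ⟩)⟩
    simp only [Finset.mem_union] at this
    rcases this with (he | he) | he
    · have := f0 _ he; dsimp only at this; omega
    · obtain ⟨a', ha', e⟩ := Finset.mem_image.1 he
      obtain ⟨rfl, e'⟩ := right_inj (hY a' (Finset.mem_range.1 ha')).1 hx (Prod.ext_iff.1 e).2
      exact e'.symm
    · have := f2 _ he; dsimp only at this; omega
  have uZ : ∀ j < leaves A M, ∀ x < D, (mid A M D j x, 2 + j) ∈ N → x = Z j := by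
    intro a ha x hx h
    have r := mid_range ha hx
    have : (mid A M D a x, 2 + a) ∈ S₀ ∪ S₁ ∪ S₂ := by
      rw [heq]
      exact Finset.mem_filter.2 ⟨h, .inr (.inr ⟨a, ha, _, hx, rfl, rfl⟩)⟩
    simp only [Finset.mem_union] at this
    rcases this with (he | he) | he
    · have := f0 _ he; dsimp only at this; omega
    · have := f1 _ he; dsimp only at this; omega
    · obtain ⟨a', ha', e⟩ := Finset.mem_image.1 he
      obtain ⟨rfl, e'⟩ := mid_inj (hZ a' (Finset.mem_range.1 ha')).1 hx (Prod.ext_iff.1 e).1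
      exact e'.symm
  refine ⟨X, fun a ha => (hX a ha).1, fun b hb => ⟨Y b, (hY b hb).1, (hY b hb).2.1,
    fun m hm => ?_⟩⟩
  obtain ⟨x, hx, k1, k2⟩ := p0 b hb m hm
  obtain ⟨y, hy, l1, l2, l3⟩ := p1 b hb m hm
  rw [← uX _ (dig_lt hb hm) x hx k2, uZ _ (leaf_lt hb hm) x hx k1,
    ← uZ _ (leaf_lt hb hm) _ (dig_lt hy hm) l2, uY b hb y hy l1 l3]

theorem network_of_solution {x : ℕ → ℕ} (hx : ∀ a < A, x a < D)
    (hs : ∀ b < A ^ M, ∃ y < D ^ M, φ b y ∧ ∀ m < M, dig D y m = x (dig A b m)) :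
    HasNetwork (order A M D) (2 + leaves A M) (arcs A M D φ) pat (budget A M) := by
  classical
  have eY : ∀ b, ∃ y, b < A ^ M → y < D ^ M ∧ φ b y ∧ ∀ m < M, dig D y m = x (dig A b m) := by
    intro b
    by_cases hb : b < A ^ M
    · obtain ⟨y, hy⟩ := hs b hb
      exact ⟨y, fun _ => hy⟩
    · exact ⟨0, fun h => absurd h hb⟩
  choose Y hY using eY
  let z : ℕ × ℕ → ℕ := fun e => mid A M D (e.1 * M + e.2) (x (dig A e.1 e.2))
  let P := Finset.range (A ^ M) ×ˢ Finset.range M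
  let S₀ := (Finset.range A).image fun a => (0, left A M D a (x a))
  let S₁ := (Finset.range (A ^ M)).image fun b => (1, right A M D b (Y b))
  let S₂ := P.image fun e => (z e, 2 + (e.1 * M + e.2))
  let S₃ := P.image fun e => (left A M D (dig A e.1 e.2) (x (dig A e.1 e.2)), z e)
  let S₄ := P.image fun e => (right A M D e.1 (Y e.1), z e)
  have hP : ∀ e ∈ P, e.1 < A ^ M ∧ e.2 < M := fun e he => by simpa [P] using he
  have hxd : ∀ e ∈ P, x (dig A e.1 e.2) < D := fun e he =>
    hx _ (dig_lt (hP e he).1 (hP e he).2)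
  have hz : ∀ e ∈ P, 2 + leaves A M ≤ z e ∧ z e < 2 + leaves A M + leaves A M * D := fun e he =>
    mid_range (leaf_lt (hP e he).1 (hP e he).2) (hxd e he)
  have d0 : ∀ e ∈ S₀, e.1 < order A M D ∧ e.2 < order A M D ∧ Heavy A M D φ e.1 e.2 := by
    intro e he
    obtain ⟨a, ha, rfl⟩ := Finset.mem_image.1 he
    rw [Finset.mem_range] at ha
    have := left_range (M := M) ha (hx a ha)
    exact ⟨by simp [order], by dsimp only [order]; omega, .inl ⟨rfl, a, ha, _, hx a ha, rfl⟩⟩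
  have d1 : ∀ e ∈ S₁, e.1 < order A M D ∧ e.2 < order A M D ∧ Heavy A M D φ e.1 e.2 := by
    intro e he
    obtain ⟨b, hb, rfl⟩ := Finset.mem_image.1 he
    rw [Finset.mem_range] at hb
    have := right_range hb (hY b hb).1
    exact ⟨by dsimp only [order]; omega, this.2,
      .inr (.inl ⟨rfl, b, hb, _, (hY b hb).1, rfl, (hY b hb).2.1⟩)⟩
  have d2 : ∀ e ∈ S₂, e.1 < order A M D ∧ e.2 < order A M D ∧ Heavy A M D φ e.1 e.2 := by
    intro e he
    obtain ⟨p, hp, rfl⟩ := Finset.mem_image.1 he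
    have := hz p hp
    have hl := leaf_lt (hP p hp).1 (hP p hp).2
    exact ⟨by dsimp only [order]; omega, by dsimp only [order]; omega,
      .inr (.inr ⟨_, hl, _, hxd p hp, rfl, rfl⟩)⟩
  have light : ∀ e ∈ S₃ ∪ S₄, e.1 < order A M D ∧ e.2 < order A M D ∧ Light A M D e.1 e.2 ∧
      ¬Heavy A M D φ e.1 e.2 := by
    intro e he
    have nh : ∀ p ∈ P, ∀ u, ¬Heavy A M D φ u (z p) := by
      rintro p hp u (⟨-, a, ha, x, hx, e⟩ | ⟨-, b, hb, y, hy, e, -⟩ | ⟨j', hj', x, hx, e', e⟩)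
      · have := left_range (M := M) ha hx; have := hz p hp; omega
      · have := right_range hb hy; have := hz p hp; omega
      · have := hz p hp; omega
    rcases Finset.mem_union.1 he with he | he <;> obtain ⟨p, hp, rfl⟩ := Finset.mem_image.1 he
    · have := hz p hp
      have := left_range (M := M) (dig_lt (hP p hp).1 (hP p hp).2) (hxd p hp)
      exact ⟨by dsimp only [order]; omega, by dsimp only [order]; omega,
        ⟨p.1, (hP p hp).1, p.2, (hP p hp).2, .inl ⟨_, hxd p hp, rfl, rfl⟩⟩, nh p hp _⟩
    · have := hz p hp
      have hy := hY p.1 (hP p hp).1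
      have := right_range (hP p hp).1 hy.1
      refine ⟨this.2, by dsimp only [order]; omega,
        ⟨p.1, (hP p hp).1, p.2, (hP p hp).2, .inr ⟨_, hy.1, rfl, ?_⟩⟩, nh p hp _⟩
      rw [hy.2.2 _ (hP p hp).2]
  refine ⟨S₀ ∪ S₁ ∪ S₂ ∪ (S₃ ∪ S₄), fun e he => ?_, fun s _ t ht hst => ?_, ?_⟩
  · rw [arcs_ne_zero]
    rcases Finset.mem_union.1 he with he | he
    · rcases Finset.mem_union.1 he with he | he
      · rcases Finset.mem_union.1 he with he | he
        · exact ⟨(d0 e he).1, (d0 e he).2.1, .inl (d0 e he).2.2⟩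
        · exact ⟨(d1 e he).1, (d1 e he).2.1, .inl (d1 e he).2.2⟩
      · exact ⟨(d2 e he).1, (d2 e he).2.1, .inl (d2 e he).2.2⟩
    · exact ⟨(light e he).1, (light e he).2.1, .inr (light e he).2.2.1⟩
  · obtain ⟨hs2, ht2⟩ := hst
    obtain ⟨j, rfl⟩ := Nat.exists_eq_add_of_le ht2
    have hj : j < leaves A M := by omega
    have hM : 0 < M := Nat.pos_of_ne_zero fun h => by simp [leaves, h] at hj
    let p : ℕ × ℕ := (j / M, j % M)
    have hp : p ∈ P := Finset.mem_product.2 ⟨Finset.mem_range.2 ((Nat.div_lt_iff_lt_mul hM).2 hj),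
      Finset.mem_range.2 (Nat.mod_lt _ hM)⟩
    have hpj : p.1 * M + p.2 = j := by
      rw [mul_comm]
      exact Nat.div_add_mod j M
    have last : (z p, 2 + j) ∈ S₀ ∪ S₁ ∪ S₂ ∪ (S₃ ∪ S₄) :=
      Finset.mem_union_left _ (Finset.mem_union_right _
        (Finset.mem_image.2 ⟨p, hp, by rw [hpj]⟩))
    obtain rfl | rfl : s = 0 ∨ s = 1 := by omega
    · refine ((Relation.ReflTransGen.single
        (b := left A M D (dig A p.1 p.2) (x (dig A p.1 p.2))) ?_).tail ?_).tail last
      · refine Finset.mem_union_left _ (Finset.mem_union_left _ (Finset.mem_union_left _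
          (Finset.mem_image.2 ⟨dig A p.1 p.2, Finset.mem_range.2 ?_, rfl⟩)))
        exact dig_lt (hP p hp).1 (hP p hp).2
      · exact Finset.mem_union_right _ (Finset.mem_union_left _ (Finset.mem_image_of_mem _ hp))
    · refine ((Relation.ReflTransGen.single (b := right A M D p.1 (Y p.1)) ?_).tail ?_).tail last
      · exact Finset.mem_union_left _ (Finset.mem_union_left _ (Finset.mem_union_right _
          (Finset.mem_image.2 ⟨p.1, Finset.mem_range.2 (hP p hp).1, rfl⟩)))
      · exact Finset.mem_union_right _ (Finset.mem_union_right _ (Finset.mem_image_of_mem _ hp))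
  · calc ∑ e ∈ S₀ ∪ S₁ ∪ S₂ ∪ (S₃ ∪ S₄), (arcs A M D φ e.1 e.2 - 1)
        = ∑ e ∈ S₀ ∪ S₁ ∪ S₂ ∪ (S₃ ∪ S₄), if Heavy A M D φ e.1 e.2 then 1 else 0 := by
          refine Finset.sum_congr rfl fun e _ => ?_
          rw [arcs_sub_one]
          by_cases h : Heavy A M D φ e.1 e.2 <;> simp [ind, h]
      _ = ((S₀ ∪ S₁ ∪ S₂ ∪ (S₃ ∪ S₄)).filter fun e => Heavy A M D φ e.1 e.2).card :=
          (Finset.card_filter _ _).symm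
      _ ≤ (S₀ ∪ S₁ ∪ S₂).card := by
          refine Finset.card_le_card fun e he => ?_
          obtain ⟨he, hh⟩ := Finset.mem_filter.1 he
          rcases Finset.mem_union.1 he with he | he
          · exact he
          · exact absurd hh (light e he).2.2.2
      _ ≤ S₀.card + S₁.card + S₂.card :=
          (Finset.card_union_le _ _).trans (Nat.add_le_add_right (Finset.card_union_le _ _) _)
      _ ≤ A + A ^ M + leaves A M := by
          refine Nat.add_le_add (Nat.add_le_add ?_ ?_) ?_
          · exact Finset.card_image_le.trans (Finset.card_range _).le
          · exact Finset.card_image_le.trans (Finset.card_range _).le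
          · refine Finset.card_image_le.trans (le_of_eq ?_)
            simp [P, leaves]

end Steiner.Gadget

/-! ### Local verification of circuits of weft one -/

namespace Param

/-- The gates of a circuit: inputs are the nodes below `n`; gates are of kind `0` (negation), `1`
(conjunction) or `2` (disjunction). -/
structure Net where
  n : ℕ
  kind : ℕ → ℕ
  len : ℕ → ℕ
  arg : ℕ → ℕ → ℕ

namespace Net

/-- The gates that have the value `bit` if and only if all arguments have the value `flip`. -/
def Universal (kind bit : ℕ) : Prop := kind = 0 ∨ (kind = 1 ∧ bit = 1) ∨ (kind = 2 ∧ bit = 0)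

/-- The value required of the arguments. -/
def flip (kind bit : ℕ) : ℕ := if kind = 0 then 1 - bit else bit

/-- Positions in the binary tree of small gates above all large gates; other nodes have
position `0`. -/
def child (path len c : ℕ) : ℕ := if path = 0 ∨ 2 < len then 0 else 2 * path + c

/-- The value `bit` of the input `v` is compatible with the known elements `z` of the set of true
inputs (`K i z` if `z - 1` is the element number `i`). -/
def InputOK (k l : ℕ) (K : ℕ → ℕ → Prop) (v bit : ℕ) : Prop :=
  (bit = 1 → ¬∃ i < k + 1, ∃ z < l, ∃ z' < l, K i z ∧ K (i + 1) z' ∧ z < v + 1 ∧ v + 1 < z') ∧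
    (bit = 0 → ¬∃ i < k + 1, K i (v + 1))

/-- The value `bit` of the node `j` is compatible with the known values `K` of the variables, up to
the depth `f`. The variable `k + 1 + path` holds the number of an argument that determines the
value of the gate at the position `path`. -/
def Chk (C : Net) (k l : ℕ) (K : ℕ → ℕ → Prop) : ℕ → ℕ → ℕ → ℕ → Prop
  | 0, j, _, bit => j < C.n → InputOK k l K j bit
  | f + 1, j, path, bit =>
    (j < C.n → InputOK k l K j bit) ∧
    (C.n ≤ j →
      (Universal (C.kind j) bit → ∀ c < C.len j,
        C.Chk k l K f (C.arg j c) (child path (C.len j) c) (flip (C.kind j) bit)) ∧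
      (¬Universal (C.kind j) bit → ∃ c < C.len j,
        (path ≠ 0 → ∀ z < l, K (k + 1 + path) z → z = c) ∧
        C.Chk k l K f (C.arg j c) (child path (C.len j) c) (flip (C.kind j) bit)))

/-- Depth and weft of the nodes below `N`. -/
structure Measure (C : Net) (N l : ℕ) (dep wf : ℕ → ℕ) : Prop where
  arg_lt : ∀ j < N, C.n ≤ j → ∀ c < C.len j, C.arg j c < N
  len_pos : ∀ j < N, C.n ≤ j → 0 < C.len j
  len_lt : ∀ j < N, C.n ≤ j → C.len j < l
  dep : ∀ j < N, C.n ≤ j → ∀ c < C.len j, dep (C.arg j c) + 1 ≤ dep j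
  weft : ∀ j < N, C.n ≤ j → ∀ c < C.len j,
    wf (C.arg j c) + (if 2 < C.len j then 1 else 0) ≤ wf j

/-- Truth values of the nodes below `N`. -/
structure Valuation (C : Net) (N : ℕ) (V : ℕ → ℕ) : Prop where
  le_one : ∀ j, V j ≤ 1
  univ : ∀ j < N, C.n ≤ j → ∀ bit ≤ 1, Universal (C.kind j) bit →
    (V j = bit ↔ ∀ c < C.len j, V (C.arg j c) = flip (C.kind j) bit)
  exist : ∀ j < N, C.n ≤ j → ∀ bit ≤ 1, ¬Universal (C.kind j) bit →
    (V j = bit ↔ ∃ c < C.len j, V (C.arg j c) = flip (C.kind j) bit)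

theorem flip_le {kind bit : ℕ} (h : bit ≤ 1) : flip kind bit ≤ 1 := by
  unfold flip; split_ifs <;> omega

theorem flip_of_not_universal {kind bit : ℕ} (h : ¬Universal kind bit) : flip kind bit = bit :=
  if_neg fun h' => h (.inl h')

/-- `s 0 = 0 < s 1 < ⋯ < s k < s (k + 1)`, and the `s i - 1` are the true inputs. -/
structure Lists (n k : ℕ) (V s : ℕ → ℕ) : Prop where
  strict : ∀ i j, i < j → j ≤ k + 1 → s i < s j
  iff : ∀ v < n, V v = 1 ↔ ∃ i < k + 1, s i = v + 1

/-- The node at a position of the tree. -/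
def nodeAt (C : Net) (out p : ℕ) : ℕ :=
  if p ≤ 1 then out else C.arg (C.nodeAt out (p / 2)) (p % 2)
termination_by p
decreasing_by omega

open Classical in
/-- The number of an argument that determines the value of a gate. -/
noncomputable def witness (C : Net) (V : ℕ → ℕ) (j : ℕ) : ℕ :=
  if h : ∃ c < C.len j, V (C.arg j c) = V j then h.choose else 0

variable {C : Net} {N k l out : ℕ} {dep wf V x : ℕ → ℕ}

theorem witness_spec {j : ℕ} (h : ∃ c < C.len j, V (C.arg j c) = V j) :
    C.witness V j < C.len j ∧ V (C.arg j (C.witness V j)) = V j := by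
  rw [witness, dif_pos h]
  exact h.choose_spec

theorem witness_lt (hl : 0 < l) (h : C.len out < l) : C.witness V out < l := by
  by_cases h' : ∃ c < C.len out, V (C.arg out c) = V out
  · exact (witness_spec h').1.trans h
  · rwa [witness, dif_neg h']

theorem inputOK_of_true {K : ℕ → ℕ → Prop} {v bit : ℕ} (hK : ∀ i z, K i z → z = x i)
    (hx : Lists C.n k V x) (hv : v < C.n) (h : V v = bit) : InputOK k l K v bit := by
  constructor
  · rintro rfl ⟨i, hi, z, -, z', -, hz, hz', h1, h2⟩
    rw [hK _ _ hz] at h1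
    rw [hK _ _ hz'] at h2
    obtain ⟨i', hi', e⟩ := (hx.iff v hv).1 h
    rcases lt_trichotomy i i' with hlt | rfl | hlt
    · rcases Nat.lt_or_ge (i + 1) i' with hlt' | hge
      · have := hx.strict (i + 1) i' hlt' (by omega); omega
      · obtain rfl : i' = i + 1 := by omega
        omega
    · omega
    · have := hx.strict i' i hlt (by omega); omega
  · rintro rfl ⟨i, hi, hz⟩
    have := (hx.iff v hv).2 ⟨i, hi, (hK _ _ hz).symm⟩
    omega

/-- True values are compatible with true knowledge. -/
theorem chk_of_true (hV : C.Valuation N V) (hm : C.Measure N l dep wf) {K : ℕ → ℕ → Prop}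
    (hK : ∀ i z, K i z → z = x i) (hx : Lists C.n k V x)
    (hw : ∀ p, p ≠ 0 → C.nodeAt out p < N → C.n ≤ C.nodeAt out p →
      x (k + 1 + p) = C.witness V (C.nodeAt out p)) :
    ∀ (f j p bit : ℕ), j < N → (p ≠ 0 → C.nodeAt out p = j) → V j = bit →
      C.Chk k l K f j p bit := by
  intro f
  induction f with
  | zero => exact fun j p bit hj _ h hjn => inputOK_of_true hK hx hjn h
  | succ f ih =>
    intro j p bit hj hp h
    have hbit : bit ≤ 1 := h ▸ hV.le_one j
    have next : ∀ c < C.len j, V (C.arg j c) = flip (C.kind j) bit → C.n ≤ j →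
        C.Chk k l K f (C.arg j c) (child p (C.len j) c) (flip (C.kind j) bit) := by
      intro c hc hv hn
      refine ih _ _ _ (hm.arg_lt j hj hn c hc) (fun hp' => ?_) hv
      unfold child at hp' ⊢
      split_ifs at hp' ⊢ with hs
      · exact absurd rfl hp'
      · push Not at hs
        rw [nodeAt, if_neg (by omega), show (2 * p + c) / 2 = p by omega,
          show (2 * p + c) % 2 = c by omega, hp hs.1]
    refine ⟨fun hn => inputOK_of_true hK hx hn h, fun hn => ⟨fun hu c hc => ?_, fun he => ?_⟩⟩
    · exact next c hc ((hV.univ j hj hn bit hbit hu).1 h c hc) hn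
    · have h1 := (hV.exist j hj hn bit hbit he).1 h
      rw [flip_of_not_universal he] at h1 next ⊢
      by_cases hp0 : p = 0
      · obtain ⟨c, hc, h2⟩ := h1
        exact ⟨c, hc, fun h => absurd hp0 h, next c hc h2 hn⟩
      · obtain ⟨g1, g2⟩ := witness_spec (h.symm ▸ h1)
        refine ⟨_, g1, fun _ z _ hz => ?_, next _ g1 (g2.trans h) hn⟩
        rw [hK _ _ hz, hw p hp0 (by rwa [hp hp0]) (by rwa [hp hp0]), hp hp0]

/-- The elements next to the inputs in the list `L` are known. -/
def Knows (k : ℕ) (x : ℕ → ℕ) (K : ℕ → ℕ → Prop) (L : List ℕ) : Prop :=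
  ∀ v ∈ L, ∃ i < k + 1, K i (x i) ∧ K (i + 1) (x (i + 1)) ∧ x i ≤ v + 1 ∧ v + 1 < x (i + 1)

theorem not_inputOK {K : ℕ → ℕ → Prop} {v bit : ℕ} (hx : Lists C.n k V x)
    (hl : ∀ i ≤ k + 1, x i < l) (hv : v < C.n) (hb : bit ≤ 1) (h1 : V v ≤ 1) (h : V v ≠ bit)
    (hK : Knows k x K [v]) : ¬InputOK k l K v bit := by
  obtain ⟨i, hi, g1, g2, g3, g4⟩ := hK v (by simp)
  rintro ⟨k1, k2⟩
  obtain rfl | rfl : bit = 0 ∨ bit = 1 := by omega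
  · refine k2 rfl ⟨i, hi, ?_⟩
    obtain ⟨i', hi', e⟩ := (hx.iff v hv).1 (by omega)
    rcases lt_trichotomy i i' with hlt | rfl | hlt
    · rcases Nat.lt_or_ge (i + 1) i' with hlt' | hge
      · have := hx.strict (i + 1) i' hlt' (by omega); omega
      · obtain rfl : i' = i + 1 := by omega
        omega
    · rwa [← e]
    · have := hx.strict i' i hlt (by omega); omega
  · refine k1 rfl ⟨i, hi, _, hl _ (by omega), _, hl _ (by omega), g1, g2, ?_, g4⟩
    refine lt_of_le_of_ne g3 fun e => h ((hx.iff v hv).2 ⟨i, hi, e⟩)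

theorem refute_local (hV : C.Valuation N V) (hm : C.Measure N l dep wf) (hx : Lists C.n k V x)
    (hl : ∀ i ≤ k + 1, x i < l) :
    ∀ (f j : ℕ), j < N → dep j ≤ f → wf j = 0 → ∃ L : List ℕ, L.length ≤ 2 ^ f ∧
      (∀ v ∈ L, v < C.n) ∧ ∀ K, Knows k x K L → ∀ bit ≤ 1, V j ≠ bit → ¬C.Chk k l K f j 0 bit := by
  intro f
  induction f with
  | zero =>
    intro j hj hd _
    have hjn : j < C.n := by
      by_contra h
      have := hm.dep j hj (by omega) 0 (hm.len_pos j hj (by omega))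
      omega
    exact ⟨[j], by simp, by simpa using hjn, fun K hK bit hb h hc =>
      not_inputOK hx hl hjn hb (hV.le_one j) h hK (hc hjn)⟩
  | succ f ih =>
    intro j hj hd hw
    by_cases hjn : j < C.n
    · exact ⟨[j], by simpa using Nat.one_le_two_pow, by simpa using hjn, fun K hK bit hb h hc =>
        not_inputOK hx hl hjn hb (hV.le_one j) h hK (hc.1 hjn)⟩
    · push Not at hjn
      have ex : ∀ c, ∃ L : List ℕ, c < C.len j → L.length ≤ 2 ^ f ∧ (∀ v ∈ L, v < C.n) ∧
          ∀ K, Knows k x K L → ∀ bit ≤ 1, V (C.arg j c) ≠ bit →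
            ¬C.Chk k l K f (C.arg j c) 0 bit := by
        intro c
        by_cases hc : c < C.len j
        · have h1 := hm.dep j hj hjn c hc
          have h2 := hm.weft j hj hjn c hc
          obtain ⟨L, hL⟩ := ih (C.arg j c) (hm.arg_lt j hj hjn c hc) (by omega) (by omega)
          exact ⟨L, fun _ => hL⟩
        · exact ⟨[], fun h => absurd h hc⟩
      choose g hg using ex
      have hlen : C.len j ≤ 2 := by
        by_contra h
        have := hm.weft j hj hjn 0 (by omega)
        rw [if_pos (by omega)] at this
        omega
      refine ⟨(List.range (C.len j)).flatMap g, ?_, ?_, ?_⟩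
      · rw [List.length_flatMap]
        refine (List.sum_le_card_nsmul _ (2 ^ f) ?_).trans ?_
        · intro r hr
          obtain ⟨c, hc, rfl⟩ := List.mem_map.1 hr
          exact (hg c (List.mem_range.1 hc)).1
        · rw [List.length_map, List.length_range, smul_eq_mul, pow_succ, mul_comm]
          exact Nat.mul_le_mul_left _ hlen
      · intro v hv
        obtain ⟨c, hc, hv⟩ := List.mem_flatMap.1 hv
        exact (hg c (List.mem_range.1 hc)).2.1 v hv
      · intro K hK bit hb hne hc
        have hc := hc.2 hjn
        have hchild : ∀ c, child 0 (C.len j) c = 0 := fun c => if_pos (.inl rfl)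
        simp only [hchild] at hc
        have ref : ∀ c < C.len j, V (C.arg j c) ≠ flip (C.kind j) bit →
            ¬C.Chk k l K f (C.arg j c) 0 (flip (C.kind j) bit) := fun c hc =>
          (hg c hc).2.2 K (fun v hv => hK v (List.mem_flatMap.2 ⟨c, List.mem_range.2 hc, hv⟩)) _
            (flip_le hb)
        by_cases hu : Universal (C.kind j) bit
        · refine hne ((hV.univ j hj hjn bit hb hu).2 fun c hcl => ?_)
          by_contra h
          exact ref c hcl h (hc.1 hu c hcl)
        · obtain ⟨c, hcl, -, h⟩ := hc.2 hu
          refine hne ((hV.exist j hj hjn bit hb hu).2 ⟨c, hcl, ?_⟩)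
          by_contra h'
          exact ref c hcl h' h

/-- A false value of a node of weft one is refuted by few inputs. -/
theorem refute (hV : C.Valuation N V) (hm : C.Measure N l dep wf) (hx : Lists C.n k V x)
    (hl : ∀ i ≤ k + 1, x i < l) {P : ℕ} (hP : ∀ p < P, x (k + 1 + p) < l) :
    ∀ (f j p bit : ℕ), j < N → dep j ≤ f → wf j ≤ 1 → p ≠ 0 → (p + 1) * 2 ^ f ≤ P → bit ≤ 1 →
      V j ≠ bit → ∃ L : List ℕ, L.length ≤ 2 ^ f ∧ (∀ v ∈ L, v < C.n) ∧
      ∀ K, Knows k x K L → (∀ p < P, K (k + 1 + p) (x (k + 1 + p))) → ¬C.Chk k l K f j p bit := by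
  intro f
  induction f with
  | zero =>
    intro j p bit hj hd _ _ _ hb h
    have hjn : j < C.n := by
      by_contra h
      have := hm.dep j hj (by omega) 0 (hm.len_pos j hj (by omega))
      omega
    exact ⟨[j], by simp, by simpa using hjn, fun K hK _ hc =>
      not_inputOK hx hl hjn hb (hV.le_one j) h hK (hc hjn)⟩
  | succ f ih =>
    intro j p bit hj hd hw hp hpP hb h
    by_cases hjn : j < C.n
    · exact ⟨[j], by simpa using Nat.one_le_two_pow, by simpa using hjn, fun K hK _ hc =>
        not_inputOK hx hl hjn hb (hV.le_one j) h hK (hc.1 hjn)⟩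
    · push Not at hjn
      have next : ∀ c < C.len j, V (C.arg j c) ≠ flip (C.kind j) bit →
          ∃ L : List ℕ, L.length ≤ 2 ^ f ∧ (∀ v ∈ L, v < C.n) ∧
          ∀ K, Knows k x K L → (∀ p < P, K (k + 1 + p) (x (k + 1 + p))) →
            ¬C.Chk k l K f (C.arg j c) (child p (C.len j) c) (flip (C.kind j) bit) := by
        intro c hc hne
        have h1 := hm.dep j hj hjn c hc
        have h2 := hm.weft j hj hjn c hc
        have h3 := hm.arg_lt j hj hjn c hc
        by_cases hs : 2 < C.len j
        · rw [if_pos hs] at h2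
          obtain ⟨L, l1, l2, l3⟩ := refute_local hV hm hx hl f (C.arg j c) h3 (by omega) (by omega)
          refine ⟨L, l1, l2, fun K hK _ => ?_⟩
          rw [child, if_pos (.inr hs)]
          exact l3 K hK _ (flip_le hb) hne
        · rw [child, if_neg (by omega)]
          refine ih _ _ _ h3 (by omega) (by omega) (by omega) (le_trans ?_ hpP) (flip_le hb) hne
          calc (2 * p + c + 1) * 2 ^ f ≤ ((p + 1) * 2) * 2 ^ f :=
                Nat.mul_le_mul_right _ (by omega)
            _ = (p + 1) * 2 ^ (f + 1) := by ring
      have mono : 2 ^ f ≤ 2 ^ (f + 1) := Nat.pow_le_pow_right (by omega) (by omega)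
      by_cases hu : Universal (C.kind j) bit
      · have h1 := mt (hV.univ j hj hjn bit hb hu).2 h
        push Not at h1
        obtain ⟨c, hc, hne⟩ := h1
        obtain ⟨L, l1, l2, l3⟩ := next c hc hne
        exact ⟨L, l1.trans mono, l2, fun K hK hK' hch => l3 K hK hK' ((hch.2 hjn).1 hu c hc)⟩
      · have h1 := mt (hV.exist j hj hjn bit hb hu).2 h
        push Not at h1
        have hpP' : p < P := by
          have := Nat.le_mul_of_pos_right (p + 1) (Nat.two_pow_pos (f + 1))
          omega
        by_cases hc : x (k + 1 + p) < C.len j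
        · obtain ⟨L, l1, l2, l3⟩ := next _ hc (h1 _ hc)
          refine ⟨L, l1.trans mono, l2, fun K hK hK' hch => ?_⟩
          obtain ⟨c, hcl, g1, g2⟩ := (hch.2 hjn).2 hu
          rw [← g1 hp _ (hP p hpP') (hK' p hpP')] at g2
          exact l3 K hK hK' g2
        · refine ⟨[], by simp, by simp, fun K hK hK' hch => ?_⟩
          obtain ⟨c, hcl, g1, g2⟩ := (hch.2 hjn).2 hu
          have := g1 hp _ (hP p hpP') (hK' p hpP')
          omega

end Net

end Param

namespace Param.Net

open RAM (dig)
open Steiner.Gadget (exists_digits dig_lt)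

/-- The values of variables known from the tuple of variables `b` and the tuple of values `y`. -/
def Known (A M l b y i z : ℕ) : Prop := ∃ m < M, dig A b m = i ∧ dig l y m = z

/-- Number of variables. -/
def vars (d k : ℕ) : ℕ := k + 1 + 2 ^ (d + 1)

/-- Length of the tuples of variables. -/
def width (d : ℕ) : ℕ := 2 ^ (d + 2)

/-- The values `y` of the tuple of variables `b` are compatible. -/
def Local (C : Net) (d k l out b y : ℕ) : Prop :=
  (∀ z < l, Known (vars d k) (width d) l b y 0 z → z = 0) ∧
  (∀ z < l, Known (vars d k) (width d) l b y (k + 1) z → z = C.n + 1) ∧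
  (∀ i < k + 1, ∀ z < l, ∀ z' < l, Known (vars d k) (width d) l b y i z →
    Known (vars d k) (width d) l b y (i + 1) z' → z < z') ∧
  C.Chk k l (Known (vars d k) (width d) l b y) d out 1 1

variable {C : Net} {N d k l out : ℕ} {dep wf : ℕ → ℕ}

theorem exists_lists {V : ℕ → ℕ} {S : Fin C.n → Bool} (hS : ∀ v : Fin C.n, V v = (S v).toNat)
    (hk : (Finset.univ.filter fun v => S v = true).card = k) :
    ∃ s, Lists C.n k V s ∧ s 0 = 0 ∧ s (k + 1) = C.n + 1 := by
  let e := (Finset.univ.filter fun v => S v = true).orderEmbOfFin hk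
  let s : ℕ → ℕ := fun i => if i = 0 then 0 else if h : i - 1 < k then (e ⟨i - 1, h⟩).val + 1
    else C.n + 1
  have s1 : ∀ i (hi : i < k), s (i + 1) = (e ⟨i, hi⟩).val + 1 := fun i hi => by simp [s, hi]
  have s2 : s (k + 1) = C.n + 1 := by simp [s]
  refine ⟨s, ⟨fun i j hij hj => ?_, fun v hv => ?_⟩, rfl, s2⟩
  · obtain ⟨j, rfl⟩ : ∃ j', j = j' + 1 := ⟨j - 1, by omega⟩
    rcases Nat.eq_zero_or_pos i with rfl | hi
    · by_cases hjk : j < k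
      · rw [s1 j hjk]; exact Nat.succ_pos _
      · obtain rfl : j = k := by omega
        rw [s2]; exact Nat.succ_pos _
    · obtain ⟨i, rfl⟩ : ∃ i', i = i' + 1 := ⟨i - 1, by omega⟩
      rw [s1 i (by omega)]
      by_cases hjk : j < k
      · rw [s1 j hjk]
        have : e ⟨i, by omega⟩ < e ⟨j, hjk⟩ := e.strictMono (by simpa using hij)
        exact Nat.succ_lt_succ this
      · obtain rfl : j = k := by omega
        rw [s2]
        exact Nat.succ_lt_succ (e ⟨i, by omega⟩).2
  · have h1 : V v = 1 ↔ (⟨v, hv⟩ : Fin C.n) ∈ Set.range e := by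
      rw [Finset.range_orderEmbOfFin]
      have := hS ⟨v, hv⟩
      dsimp only at this
      rw [this]
      simp
    rw [h1]
    constructor
    · rintro ⟨i, hi⟩
      exact ⟨i + 1, by omega, by rw [s1 i i.2, hi]⟩
    · rintro ⟨i, hi, h⟩
      rcases Nat.eq_zero_or_pos i with rfl | hi'
      · exact absurd h (Nat.succ_ne_zero v).symm
      · obtain ⟨i, rfl⟩ : ∃ i', i = i' + 1 := ⟨i - 1, by omega⟩
        rw [s1 i (by omega)] at h
        exact ⟨⟨i, by omega⟩, Fin.ext (by simpa using h)⟩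

theorem exists_assignment {s : ℕ → ℕ} (hs : ∀ i j, i < j → j ≤ k + 1 → s i < s j) (h0 : s 0 = 0)
    (h1 : s (k + 1) = C.n + 1) : ∃ S : Fin C.n → Bool,
      (Finset.univ.filter fun v => S v = true).card = k ∧
      ∀ v : Fin C.n, S v = true ↔ ∃ i < k + 1, s i = v + 1 := by
  classical
  refine ⟨fun v => decide (∃ i < k + 1, s i = v + 1), ?_, fun v => by simp⟩
  have hb : ∀ i, i < k → s (i + 1) - 1 < C.n ∧ 0 < s (i + 1) := fun i hi => by
    have := hs (i + 1) (k + 1) (by omega) le_rfl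
    have := hs 0 (i + 1) (by omega) (by omega)
    omega
  have hinj : ∀ i < k, ∀ j < k, s (i + 1) = s (j + 1) → i = j := by
    intro i hi j hj h
    rcases lt_trichotomy i j with hij | hij | hij
    · have := hs (i + 1) (j + 1) (by omega) (by omega); omega
    · exact hij
    · have := hs (j + 1) (i + 1) (by omega) (by omega); omega
  let f : Fin k → Fin C.n := fun i => ⟨s (i + 1) - 1, (hb i i.2).1⟩
  have hf : Function.Injective f := by
    intro i j h
    have h := congrArg Fin.val h
    have := hb i i.2
    have := hb j j.2
    exact Fin.ext (hinj i i.2 j j.2 (by simp only [f] at h; omega))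
  have : (Finset.univ.filter fun v : Fin C.n => decide (∃ i < k + 1, s i = v + 1) = true) =
      Finset.univ.image f := by
    ext v
    simp only [decide_eq_true_eq, Finset.mem_filter, Finset.mem_univ, true_and, Finset.mem_image]
    constructor
    · rintro ⟨i, hi, h⟩
      rcases Nat.eq_zero_or_pos i with rfl | hi'
      · omega
      · exact ⟨⟨i - 1, by omega⟩, Fin.ext (by simp [f, Nat.sub_add_cancel hi', h])⟩
    · rintro ⟨i, rfl⟩
      have := hb i i.2
      exact ⟨i + 1, by omega, by simp only [f]; omega⟩
  rw [this, Finset.card_image_of_injective _ hf, Finset.card_univ, Fintype.card_fin]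

/-- The knowledge of few variables is consistent. -/
theorem exists_known {x : ℕ → ℕ} {A M : ℕ} {φ : ℕ → ℕ → Prop} (hA : 0 < A)
    (hx : ∀ b < A ^ M, ∃ y < l ^ M, φ b y ∧ ∀ m < M, dig l y m = x (dig A b m)) (L : List ℕ)
    (hL : L.length ≤ M) (hLA : ∀ i ∈ L, i < A) :
    ∃ b y, φ b y ∧ ∀ i ∈ L, Known A M l b y i (x i) := by
  obtain ⟨b, hb, h⟩ := exists_digits (D := A) (M := M) (z := fun m => L.getD m 0) fun m _ => by
    by_cases hm : m < L.length
    · rw [List.getD_eq_getElem _ _ hm]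
      exact hLA _ (List.getElem_mem hm)
    · rwa [List.getD_eq_default _ _ (by omega)]
  obtain ⟨y, _, hφ, hd⟩ := hx b hb
  refine ⟨b, y, hφ, fun i hi => ?_⟩
  obtain ⟨m, hm, rfl⟩ := List.getElem_of_mem hi
  have e : dig A b m = L[m] := by
    rw [h m (by omega), List.getD_eq_getElem _ _ hm]
  exact ⟨m, by omega, e, by rw [hd m (by omega), e]⟩

/-- Weighted satisfiability as a constraint system. -/
theorem constraints_iff (hm : C.Measure N l dep wf) (hn : C.n + 1 < l) (hout : out < N)
    (hd : dep out ≤ d) (hw : wf out ≤ 1) {V : (Fin C.n → Bool) → ℕ → ℕ}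
    (hV : ∀ S, C.Valuation N (V S)) (hS : ∀ S (v : Fin C.n), V S v = (S v).toNat) :
    (∃ x : ℕ → ℕ, (∀ a < vars d k, x a < l) ∧ ∀ b < vars d k ^ width d, ∃ y < l ^ width d,
      C.Local d k l out b y ∧ ∀ m < width d, dig l y m = x (dig (vars d k) b m)) ↔
    ∃ S : Fin C.n → Bool, (Finset.univ.filter fun v => S v = true).card = k ∧ V S out = 1 := by
  constructor
  · rintro ⟨x, hxl, hx⟩
    have hA : 0 < vars d k := by unfold vars; positivity
    have h4 : 4 ≤ width d := by
      unfold width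
      rw [pow_add]
      have := Nat.two_pow_pos d
      omega
    have pick := fun L => exists_known (φ := C.Local d k l out) hA hx L
    have hlt : ∀ i ≤ k + 1, i < vars d k := fun i hi => by
      unfold vars
      have := Nat.one_lt_two_pow (n := d + 1) (by omega)
      omega
    have x0 : x 0 = 0 := by
      obtain ⟨b, y, hφ, hK⟩ := pick [0] (by simp; omega) (by simpa using hA)
      exact hφ.1 _ (hxl 0 hA) (hK 0 (by simp))
    have x1 : x (k + 1) = C.n + 1 := by
      obtain ⟨b, y, hφ, hK⟩ := pick [k + 1] (by simp; omega) (by simpa using hlt _ le_rfl)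
      exact hφ.2.1 _ (hxl _ (hlt _ le_rfl)) (hK _ (by simp))
    have xs : ∀ i < k + 1, x i < x (i + 1) := by
      intro i hi
      obtain ⟨b, y, hφ, hK⟩ := pick [i, i + 1] (by simp; omega)
        (by simpa using ⟨hlt _ (by omega), hlt _ (by omega)⟩)
      exact hφ.2.2.1 i hi _ (hxl _ (hlt _ (by omega))) _ (hxl _ (hlt _ (by omega)))
        (hK i (by simp)) (hK (i + 1) (by simp))
    have xm : ∀ i j, i < j → j ≤ k + 1 → x i < x j := by
      intro i j
      induction j with
      | zero => omega
      | succ j ih =>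
        intro hij hj
        have h1 := xs j (by omega)
        rcases Nat.lt_succ_iff_lt_or_eq.1 hij with h | rfl
        · exact (ih h (by omega)).trans h1
        · exact h1
    obtain ⟨S, hS1, hS2⟩ := exists_assignment xm x0 x1
    refine ⟨S, hS1, ?_⟩
    have hx : Lists C.n k (V S) x := ⟨xm, fun v hv => by
      rw [← hS2 ⟨v, hv⟩, hS S ⟨v, hv⟩]
      cases S ⟨v, hv⟩ <;> simp⟩
    by_contra hne
    obtain ⟨L, l1, l2, l3⟩ := refute (hV S) hm hx (fun i hi => hxl i (hlt i hi))
      (P := 2 ^ (d + 1)) (fun p hp => hxl _ (by unfold vars; omega)) d out 1 1 hout hd hw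
      (by omega) (by rw [pow_succ]; omega) le_rfl hne
    have gap : ∀ v, ∃ i, v < C.n → i < k + 1 ∧ x i ≤ v + 1 ∧ v + 1 < x (i + 1) := by
      intro v
      by_cases hv : v < C.n
      · have h1 : ∃ i, v + 1 < x (i + 1) := ⟨k, by omega⟩
        refine ⟨Nat.find h1, fun _ => ⟨?_, ?_, Nat.find_spec h1⟩⟩
        · have := Nat.find_min' h1 (m := k) (by omega)
          omega
        · rcases Nat.eq_zero_or_pos (Nat.find h1) with h0 | h0
          · rw [h0, x0]; omega
          · have := Nat.find_min h1 (m := Nat.find h1 - 1) (by omega)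
            rw [Nat.sub_add_cancel h0] at this
            omega
      · exact ⟨0, fun h => absurd h hv⟩
    choose g hg using gap
    obtain ⟨b, y, hφ, hK⟩ := pick ((List.range (2 ^ (d + 1))).map (k + 1 + ·) ++
        L.flatMap fun v => [g v, g v + 1]) (by
      have : (L.flatMap fun v => [g v, g v + 1]).length = L.length * 2 := by
        rw [List.length_flatMap]
        simp
      rw [List.length_append, List.length_map, List.length_range, this, width, pow_succ 2 (d + 1)]
      have : 2 ^ (d + 1) = 2 ^ d * 2 := pow_succ _ _
      omega) (by
      intro i hi
      rcases List.mem_append.1 hi with hi | hi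
      · obtain ⟨p, hp, rfl⟩ := List.mem_map.1 hi
        have := List.mem_range.1 hp
        unfold vars; omega
      · obtain ⟨v, hv, hi⟩ := List.mem_flatMap.1 hi
        have := (hg v (l2 v hv)).1
        simp only [List.mem_cons, List.not_mem_nil, or_false] at hi
        exact hlt i (by omega))
    refine l3 _ (fun v hv => ?_) (fun p hp => ?_) hφ.2.2.2
    · obtain ⟨h1, h2, h3⟩ := hg v (l2 v hv)
      exact ⟨g v, h1,
        hK _ (List.mem_append_right _ (List.mem_flatMap.2 ⟨v, hv, by simp⟩)),
        hK _ (List.mem_append_right _ (List.mem_flatMap.2 ⟨v, hv, by simp⟩)), h2, h3⟩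
    · exact hK _ (List.mem_append_left _ (List.mem_map.2 ⟨p, List.mem_range.2 hp, rfl⟩))
  · rintro ⟨S, hk, hout1⟩
    obtain ⟨s, hs, s0, s1⟩ := exists_lists (hS S) hk
    let w : ℕ → ℕ := fun p => C.witness (V S) (C.nodeAt out p)
    let x : ℕ → ℕ := fun a => if a ≤ k + 1 then s a else if w (a - (k + 1)) < l then w (a - (k + 1))
      else 0
    have xs : ∀ i ≤ k + 1, x i = s i := fun i hi => if_pos hi
    have xw : ∀ p, p ≠ 0 → C.nodeAt out p < N → C.n ≤ C.nodeAt out p → x (k + 1 + p) = w p :=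
      fun p hp h1 h2 => by
        have := witness_lt (V := V S) (by omega) (hm.len_lt _ h1 h2)
        simp only [x]
        rw [if_neg (by omega), Nat.add_sub_cancel_left, if_pos this]
    have hx : Lists C.n k (V S) x := by
      refine ⟨fun i j hij hj => ?_, fun v hv => (hs.iff v hv).trans ?_⟩
      · rw [xs i (by omega), xs j hj]
        exact hs.strict i j hij hj
      · refine exists_congr fun i => and_congr_right fun hi => ?_
        rw [xs i (by omega)]
    have hsl : ∀ i ≤ k + 1, s i < l := by
      intro i hi
      rcases Nat.lt_or_eq_of_le hi with h | rfl
      · have := hs.strict i (k + 1) h le_rfl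
        omega
      · omega
    have hxl : ∀ a, x a < l := by
      intro a
      simp only [x]
      split_ifs with h1 h2
      · exact hsl a h1
      · exact h2
      · omega
    refine ⟨x, fun a _ => hxl a, fun b hb => ?_⟩
    obtain ⟨y, hy, hd⟩ := exists_digits (D := l) (M := width d)
      (z := fun m => x (dig (vars d k) b m)) fun m _ => hxl _
    have hK : ∀ i z, Known (vars d k) (width d) l b y i z → z = x i := by
      rintro i z ⟨m, hm, rfl, rfl⟩
      exact hd m hm
    refine ⟨y, hy, ⟨fun z _ hz => ?_, fun z _ hz => ?_, fun i hi z _ z' _ hz hz' => ?_, ?_⟩, hd⟩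
    · rw [hK _ _ hz, xs 0 (by omega), s0]
    · rw [hK _ _ hz, xs _ le_rfl, s1]
    · rw [hK _ _ hz, hK _ _ hz']
      exact hx.strict _ _ (by omega) (by omega)
    · exact chk_of_true (hV S) hm hK hx xw d out 1 1 hout (fun _ => by rw [nodeAt, if_pos le_rfl])
        hout1

end Param.Net

/-! ### The word of a circuit -/

namespace Param

/-- The place of the gate number `i` in the word of an instance. -/
def offset (data : ℕ → ℕ) : ℕ → ℕ
  | 0 => 4 + data 1
  | i + 1 => offset data i + 2 + data (offset data i + 1)

/-- The gates of the circuit in the word of an instance. -/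
def netOf (data : ℕ → ℕ) : Net where
  n := data 1
  kind j := data (offset data (j - data 1))
  len j := data (offset data (j - data 1) + 1)
  arg j c := data (offset data (j - data 1) + 2 + c)

def Gate.kind : Gate → ℕ
  | .not _ => 0
  | .and _ => 1
  | .or _ => 2

theorem Gate.encode_eq (g : Gate) : g.encode = g.kind :: g.args.length :: g.args := by
  cases g <;> rfl

theorem getD_add_eq_drop {w : List ℕ} {a i : ℕ} : w.getD (a + i) 0 = (w.drop a).getD i 0 := by
  simp [List.getD_eq_getElem?_getD]

section

variable {C : Circuit} {k : ℕ}

/-- The letters of the word of an instance. -/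
def letter (C : Circuit) (k i : ℕ) : ℕ := (k :: C.encode).getD i 0

theorem drop_offset {i : ℕ} (hi : i ≤ C.gates.length) :
    (k :: C.encode).drop (offset (letter C k) i) = (C.gates.drop i).flatMap Gate.encode := by
  induction i with
  | zero =>
    have : offset (letter C k) 0 = C.inputs + 4 := add_comm _ _
    rw [this]
    simp [Circuit.encode]
  | succ i ih =>
    have ih := ih (by omega)
    rw [List.drop_eq_getElem_cons (show i < C.gates.length by omega), List.flatMap_cons,
      Gate.encode_eq] at ih
    have h1 : letter C k (offset (letter C k) i + 1) = C.gates[i].args.length := by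
      rw [letter, getD_add_eq_drop, ih]
      simp
    rw [offset, h1, add_assoc, ← List.drop_drop, ih, add_comm 2]
    simp

theorem letter_offset {i r : ℕ} (hi : i < C.gates.length)
    (hr : r < C.gates[i].encode.length) :
    letter C k (offset (letter C k) i + r) = C.gates[i].encode[r] := by
  rw [letter, getD_add_eq_drop, drop_offset hi.le, List.drop_eq_getElem_cons hi,
    List.flatMap_cons, List.getD_append _ _ _ _ hr, List.getD_eq_getElem _ _ hr]

theorem netOf_kind {i : ℕ} (hi : i < C.gates.length) :
    (netOf (letter C k)).kind (C.inputs + i) = C.gates[i].kind := by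
  change letter C k (offset (letter C k) (C.inputs + i - C.inputs)) = _
  rw [Nat.add_sub_cancel_left]
  have := letter_offset (k := k) (r := 0) hi (by simp [Gate.encode_eq])
  simpa [Gate.encode_eq] using this

theorem netOf_len {i : ℕ} (hi : i < C.gates.length) :
    (netOf (letter C k)).len (C.inputs + i) = C.gates[i].args.length := by
  change letter C k (offset (letter C k) (C.inputs + i - C.inputs) + 1) = _
  rw [Nat.add_sub_cancel_left]
  have := letter_offset (k := k) (r := 1) hi (by simp [Gate.encode_eq])
  simpa [Gate.encode_eq] using this

theorem netOf_arg {i c : ℕ} (hi : i < C.gates.length) (hc : c < C.gates[i].args.length) :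
    (netOf (letter C k)).arg (C.inputs + i) c = C.gates[i].args[c] := by
  change letter C k (offset (letter C k) (C.inputs + i - C.inputs) + 2 + c) = _
  rw [Nat.add_sub_cancel_left]
  have := letter_offset (k := k) (r := 2 + c) hi (by simp [Gate.encode_eq]; omega)
  simpa [Gate.encode_eq, add_assoc, add_comm 2 c] using this

theorem foldl_table {α : Type} (d : α) (step : Gate → List α → α) (base : List α)
    (gs : List Gate) :
    (gs.foldl (fun t g => t ++ [step g t]) base).length = base.length + gs.length ∧
    (∀ j < base.length,
      (gs.foldl (fun t g => t ++ [step g t]) base).getD j d = base.getD j d) ∧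
    ∀ (i : ℕ) (h : i < gs.length), ∃ t,
      (gs.foldl (fun t g => t ++ [step g t]) base).getD (base.length + i) d = step gs[i] t ∧
      ∀ j < base.length + i,
        t.getD j d = (gs.foldl (fun t g => t ++ [step g t]) base).getD j d := by
  induction gs using List.reverseRecOn with
  | nil => simp
  | append_singleton gs g ih =>
    obtain ⟨h1, h2, h3⟩ := ih
    rw [List.foldl_append, List.foldl_cons, List.foldl_nil]
    set T := gs.foldl (fun t g => t ++ [step g t]) base with hT
    have hold : ∀ j < base.length + gs.length, (T ++ [step g T]).getD j d = T.getD j d :=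
      fun j hj => List.getD_append _ _ _ _ (by omega)
    refine ⟨by simp [h1, add_assoc], fun j hj => ?_, fun i hi => ?_⟩
    · rw [hold j (by omega), h2 j hj]
    · rw [List.length_append, List.length_singleton] at hi
      rcases Nat.lt_succ_iff_lt_or_eq.1 hi with hi | rfl
      · obtain ⟨t, g1, g2⟩ := h3 i hi
        refine ⟨t, ?_, fun j hj => ?_⟩
        · rw [hold _ (by omega), g1, List.getElem_append_left hi]
        · rw [hold _ (by omega), g2 j hj]
      · refine ⟨T, ?_, fun j hj => (hold j hj).symm⟩
        rw [List.getD_append_right _ _ _ _ (by omega), h1]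
        simp

def depthAt (C : Circuit) (j : ℕ) : ℕ :=
  (C.table (List.replicate C.inputs 0) fun g tbl =>
    (g.args.map fun j => tbl.getD j 0).foldr max 0 + 1).getD j 0

def weftAt (C : Circuit) (j : ℕ) : ℕ :=
  (C.table (List.replicate C.inputs 0) fun g tbl =>
    (g.args.map fun j => tbl.getD j 0).foldr max 0 +
      if 2 < g.args.length then 1 else 0).getD j 0

def valueAt (C : Circuit) (x : Fin C.inputs → Bool) (j : ℕ) : Bool :=
  (C.table (List.ofFn x) fun g tbl => g.value tbl).getD j false

theorem le_foldr_max {l : List ℕ} {a : ℕ} (h : a ∈ l) : a ≤ l.foldr max 0 := by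
  induction l with
  | nil => simp at h
  | cons b l ih =>
    rcases List.mem_cons.1 h with rfl | h
    · exact le_max_left _ _
    · exact (ih h).trans (le_max_right _ _)

theorem depthAt_arg {i : ℕ} (hi : i < C.gates.length) {j : ℕ} (hj : j ∈ C.gates[i].args) :
    depthAt C j + 1 ≤ depthAt C (C.inputs + i) := by
  obtain ⟨t, h1, h2⟩ := (foldl_table 0 (fun g tbl =>
    (g.args.map fun j => tbl.getD j 0).foldr max 0 + 1) (List.replicate C.inputs 0) C.gates).2.2 i hi
  rw [List.length_replicate] at h1 h2
  obtain ⟨c, hc, rfl⟩ := List.getElem_of_mem hj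
  have h2 := h2 _ (C.args_lt i hi _ hj)
  refine le_trans ?_ (le_of_eq h1.symm)
  refine Nat.add_le_add_right (le_foldr_max ?_) 1
  rw [depthAt, Circuit.table, ← h2]
  exact List.mem_map_of_mem hj

theorem weftAt_arg {i : ℕ} (hi : i < C.gates.length) {j : ℕ} (hj : j ∈ C.gates[i].args) :
    weftAt C j + (if 2 < C.gates[i].args.length then 1 else 0) ≤ weftAt C (C.inputs + i) := by
  obtain ⟨t, h1, h2⟩ := (foldl_table 0 (fun g tbl =>
    (g.args.map fun j => tbl.getD j 0).foldr max 0 + if 2 < g.args.length then 1 else 0)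
    (List.replicate C.inputs 0) C.gates).2.2 i hi
  rw [List.length_replicate] at h1 h2
  have h2 := h2 _ (C.args_lt i hi _ hj)
  refine le_trans ?_ (le_of_eq h1.symm)
  refine Nat.add_le_add_right (le_foldr_max ?_) _
  rw [weftAt, Circuit.table, ← h2]
  exact List.mem_map_of_mem hj

theorem valueAt_input (x : Fin C.inputs → Bool) (v : Fin C.inputs) : valueAt C x v = x v := by
  have := (foldl_table false (fun g tbl => g.value tbl) (List.ofFn x) C.gates).2.1 v (by simp)
  refine this.trans ?_
  simp [List.getD_eq_getElem?_getD]

theorem valueAt_gate (x : Fin C.inputs → Bool) {i : ℕ} (hi : i < C.gates.length) :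
    ∃ t, valueAt C x (C.inputs + i) = (C.gates[i]).value t ∧
      ∀ j ∈ C.gates[i].args, t.getD j false = valueAt C x j := by
  obtain ⟨t, h1, h2⟩ :=
    (foldl_table false (fun g tbl => g.value tbl) (List.ofFn x) C.gates).2.2 i hi
  rw [List.length_ofFn] at h1 h2
  exact ⟨t, h1, fun j hj => h2 j (C.args_lt i hi j hj)⟩

theorem Gate.Proper.args_pos {g : Gate} (h : g.Proper) : 0 < g.args.length := by
  cases g with
  | not j => simp [Gate.args]
  | and js => exact lt_of_lt_of_le (by omega) h.1
  | or js => exact lt_of_lt_of_le (by omega) h.1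

theorem length_flatMap_encode (gs : List Gate) :
    gs.length ≤ (gs.flatMap Gate.encode).length ∧
      ∀ g ∈ gs, g.args.length ≤ (gs.flatMap Gate.encode).length := by
  induction gs with
  | nil => simp
  | cons g gs ih =>
    simp only [List.flatMap_cons, List.length_append, List.length_cons, Gate.encode_eq,
      List.mem_cons]
    refine ⟨by omega, ?_⟩
    rintro g' (rfl | h)
    · omega
    · have := ih.2 g' h
      omega

theorem word_length : (k :: C.encode).length =
    4 + C.inputs + (C.gates.flatMap Gate.encode).length := by
  simp [Circuit.encode]; omega

theorem measure_netOf : (netOf (letter C k)).Measure (C.inputs + C.gates.length)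
    (k :: C.encode).length (depthAt C) (weftAt C) := by
  have ex : ∀ j < C.inputs + C.gates.length, C.inputs ≤ j →
      ∃ i < C.gates.length, j = C.inputs + i := fun j h1 h2 => ⟨j - C.inputs, by omega, by omega⟩
  constructor
  · intro j hj hn c hc
    obtain ⟨i, hi, rfl⟩ := ex j hj hn
    rw [netOf_len hi] at hc
    rw [netOf_arg hi hc]
    have := C.args_lt i hi _ (List.getElem_mem hc)
    omega
  · intro j hj hn
    obtain ⟨i, hi, rfl⟩ := ex j hj hn
    rw [netOf_len hi]
    exact (C.proper _ (List.getElem_mem hi)).args_pos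
  · intro j hj hn
    obtain ⟨i, hi, rfl⟩ := ex j hj hn
    rw [netOf_len hi, word_length]
    have := (length_flatMap_encode C.gates).2 _ (List.getElem_mem hi)
    omega
  · intro j hj hn c hc
    obtain ⟨i, hi, rfl⟩ := ex j hj hn
    rw [netOf_len hi] at hc
    rw [netOf_arg hi hc]
    exact depthAt_arg hi (List.getElem_mem hc)
  · intro j hj hn c hc
    obtain ⟨i, hi, rfl⟩ := ex j hj hn
    rw [netOf_len hi] at hc ⊢
    rw [netOf_arg hi hc]
    exact weftAt_arg hi (List.getElem_mem hc)

theorem forall_arg {i : ℕ} (hi : i < C.gates.length) {p : ℕ → Prop} :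
    (∀ c < (netOf (letter C k)).len (C.inputs + i), p ((netOf (letter C k)).arg (C.inputs + i) c)) ↔
      ∀ j ∈ C.gates[i].args, p j := by
  rw [netOf_len hi]
  constructor
  · intro h j hj
    obtain ⟨c, hc, rfl⟩ := List.getElem_of_mem hj
    rw [← netOf_arg (k := k) hi hc]
    exact h c hc
  · intro h c hc
    rw [netOf_arg hi hc]
    exact h _ (List.getElem_mem hc)

theorem exists_arg {i : ℕ} (hi : i < C.gates.length) {p : ℕ → Prop} :
    (∃ c < (netOf (letter C k)).len (C.inputs + i), p ((netOf (letter C k)).arg (C.inputs + i) c)) ↔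
      ∃ j ∈ C.gates[i].args, p j := by
  have := not_congr (forall_arg (k := k) hi (p := fun j => ¬p j))
  push Not at this
  exact this

theorem valuation_netOf (x : Fin C.inputs → Bool) : (netOf (letter C k)).Valuation
    (C.inputs + C.gates.length) fun j => (valueAt C x j).toNat := by
  have ex : ∀ j < C.inputs + C.gates.length, C.inputs ≤ j →
      ∃ i < C.gates.length, j = C.inputs + i := fun j h1 h2 => ⟨j - C.inputs, by omega, by omega⟩
  refine ⟨fun j => Bool.toNat_le _, fun j hj hn bit hb hu => ?_, fun j hj hn bit hb hu => ?_⟩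
  all_goals
    obtain ⟨i, hi, rfl⟩ := ex j hj hn
    obtain ⟨t, h1, h2⟩ := valueAt_gate x hi
    rw [netOf_kind hi] at hu ⊢
    obtain rfl | rfl : bit = 0 ∨ bit = 1 := by omega
  · rw [forall_arg hi (p := fun r => (valueAt C x r).toNat = Net.flip C.gates[i].kind 0), h1]
    generalize C.gates[i] = g at *
    cases g with
    | not r =>
      have := h2 r (by simp [Gate.args])
      simpa [Gate.value, Net.flip, Gate.kind, Gate.args] using this
    | and js => simp [Net.Universal, Gate.kind] at hu
    | or js =>
      simp only [Gate.args] at h2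
      simp +contextual [Gate.value, Net.flip, Gate.kind, Gate.args, ← h2]
  · rw [forall_arg hi (p := fun r => (valueAt C x r).toNat = Net.flip C.gates[i].kind 1), h1]
    generalize C.gates[i] = g at *
    cases g with
    | not r =>
      have := h2 r (by simp [Gate.args])
      simpa [Gate.value, Net.flip, Gate.kind, Gate.args] using this
    | and js =>
      simp only [Gate.args] at h2
      simp +contextual [Gate.value, Net.flip, Gate.kind, Gate.args, ← h2]
    | or js => simp [Net.Universal, Gate.kind] at hu
  · rw [exists_arg hi (p := fun r => (valueAt C x r).toNat = Net.flip C.gates[i].kind 0), h1]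
    generalize C.gates[i] = g at *
    cases g with
    | not r => simp [Net.Universal, Gate.kind] at hu
    | and js =>
      simp only [Gate.args] at h2
      simp [Gate.value, Net.flip, Gate.kind, Gate.args]
      exact exists_congr fun r => and_congr_right fun hr => by rw [← h2 r hr]; simp
    | or js => simp [Net.Universal, Gate.kind] at hu
  · rw [exists_arg hi (p := fun r => (valueAt C x r).toNat = Net.flip C.gates[i].kind 1), h1]
    generalize C.gates[i] = g at *
    cases g with
    | not r => simp [Net.Universal, Gate.kind] at hu
    | and js => simp [Net.Universal, Gate.kind] at hu
    | or js =>
      simp only [Gate.args] at h2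
      simp [Gate.value, Net.flip, Gate.kind, Gate.args]
      exact exists_congr fun r => and_congr_right fun hr => by rw [← h2 r hr]; simp

theorem letter_le (i : ℕ) : letter C k i ≤ k + (k :: C.encode).length := by
  have key : ∀ a ∈ k :: C.encode, a ≤ k + (k :: C.encode).length := by
    have hl := length_flatMap_encode C.gates
    have ho := C.output_lt
    rw [word_length]
    intro a ha
    simp only [Circuit.encode, List.mem_cons, List.mem_append, List.mem_replicate,
      List.mem_flatMap] at ha
    rcases ha with rfl | rfl | rfl | rfl | ⟨-, rfl⟩ | ⟨g, hg, ha⟩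
    · omega
    · omega
    · omega
    · omega
    · omega
    · have h1 := hl.2 g hg
      rw [Gate.encode_eq] at ha
      simp only [List.mem_cons] at ha
      rcases ha with rfl | rfl | ha
      · cases g <;> simp [Gate.kind] <;> omega
      · omega
      · obtain ⟨i, hi, rfl⟩ := List.getElem_of_mem hg
        have := C.args_lt i hi a ha
        omega
  unfold letter
  by_cases hi : i < (k :: C.encode).length
  · rw [List.getD_eq_getElem _ _ hi]
    exact key _ (List.getElem_mem hi)
  · rw [List.getD_eq_default _ _ (by omega)]
    omega

end

end Param

/-! ### The reduction in polynomial time -/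

namespace RAM

open Param Param.Net Steiner.Gadget

variable {α : Type} [Ctx α]

theorem Comp.offset {F : Input → α → ℕ} (hF : Comp F) :
    Comp (fun I a => offset I.data (F I a)) := by
  let H : Input → (α × ℕ) × ℕ → ℕ := fun I a => a.2 + 2 + I.data (a.2 + 1)
  have hH : Comp H := (Comp.last.add (.const 2)).add (Comp.last.add (.const 1)).get
  let S : Input → α → ℕ := fun I _ => 4 + I.data 1
  have hS : Comp S := (Comp.const 4).add (Comp.const 1).get
  have key : ∀ I a j, acc S H I a j = Param.offset I.data j := by
    intro I a j
    induction j with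
    | zero => rfl
    | succ j ih => simp only [acc, H, ih, Param.offset]
  have bound : ∀ (I : Input) j, Param.offset I.data j ≤ 4 + I.size + j * (2 + I.size) := by
    intro I j
    induction j with
    | zero =>
      have := I.le 1
      simp only [Param.offset]; omega
    | succ j ih =>
      have := I.le (Param.offset I.data j + 1)
      simp only [Param.offset, add_mul]; omega
  have := Comp.fold hS hF hH ((((PolyB.const 4).add PolyB.size).add
    (Comp.last.1.mul ((PolyB.const 2).add PolyB.size))).mono fun I a => by
      rw [key]
      exact bound I a.2)
  simp only [key] at this
  exact this

theorem Comp.net_n : Comp (fun I (_ : α) => (netOf I.data).n) := (Comp.const 1).get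

theorem Comp.net_kind {J : Input → α → ℕ} (hJ : Comp J) :
    Comp (fun I a => (netOf I.data).kind (J I a)) :=
  (hJ.sub (Comp.const 1).get).offset.get

theorem Comp.net_len {J : Input → α → ℕ} (hJ : Comp J) :
    Comp (fun I a => (netOf I.data).len (J I a)) :=
  ((hJ.sub (Comp.const 1).get).offset.add (.const 1)).get

theorem Comp.net_arg {J C : Input → α → ℕ} (hJ : Comp J) (hC : Comp C) :
    Comp (fun I a => (netOf I.data).arg (J I a) (C I a)) :=
  (((hJ.sub (Comp.const 1).get).offset.add (.const 2)).add hC).get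

theorem Comp.vars (d : ℕ) : Comp (fun I (_ : α) => vars d (I.data 0)) :=
  ((Comp.const 0).get.add (.const 1)).add (.const _)

theorem CompP.universal {F G : Input → α → ℕ} (hF : Comp F) (hG : Comp G) :
    CompP (fun I a => Universal (F I a) (G I a)) :=
  .or (.eq hF (.const 0)) (.or (.and (.eq hF (.const 1)) (.eq hG (.const 1)))
    (.and (.eq hF (.const 2)) (.eq hG (.const 0))))

theorem Comp.flip {F G : Input → α → ℕ} (hF : Comp F) (hG : Comp G) :
    Comp (fun I a => flip (F I a) (G I a)) :=
  .ite (.eq hF (.const 0)) (.sub (.const 1) hG) hG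

theorem Comp.child {F G H : Input → α → ℕ} (hF : Comp F) (hG : Comp G) (hH : Comp H) :
    Comp (fun I a => child (F I a) (G I a) (H I a)) :=
  .ite (.or (.eq hF (.const 0)) (.lt (.const 2) hG)) (.const 0) (.add (.mul (.const 2) hF) hH)

theorem CompP.known {A M l b y i z : Input → α → ℕ} (hA : Comp A) (hM : Comp M) (hl : Comp l)
    (hb : Comp b) (hy : Comp y) (hi : Comp i) (hz : Comp z) :
    CompP (fun I a => Known (A I a) (M I a) (l I a) (b I a) (y I a) (i I a) (z I a)) :=
  .ex hM (.and (.eq (.dig hA.weak hb.weak .last) hi.weak)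
    (.eq (.dig hl.weak hy.weak .last) hz.weak))

/-- The knowledge given by tuples of variables and values. -/
def knownFrom (d : ℕ) (I : Input) (l b y : ℕ) : ℕ → ℕ → Prop :=
  Known (Net.vars d (I.data 0)) (width d) l b y

theorem CompP.knowledge {d : ℕ} {l b y i z : Input → α → ℕ} (hl : Comp l) (hb : Comp b)
    (hy : Comp y) (hi : Comp i) (hz : Comp z) :
    CompP (fun I a => knownFrom d I (l I a) (b I a) (y I a) (i I a) (z I a)) :=
  .known (.vars d) (.const _) hl hb hy hi hz

theorem CompP.inputOK {d : ℕ} {l b y v bit : Input → α → ℕ} (hl : Comp l) (hb : Comp b)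
    (hy : Comp y) (hv : Comp v) (hbit : Comp bit) :
    CompP (fun I a => InputOK (I.data 0) (l I a) (knownFrom d I (l I a) (b I a) (y I a))
      (v I a) (bit I a)) := by
  have hk : ∀ {β : Type} [Ctx β], Comp (fun I (_ : β) => I.data 0 + 1) :=
    (Comp.const 0).get.add (.const 1)
  have h1 : Comp (fun I (a : ((α × ℕ) × ℕ) × ℕ) => v I a.1.1.1 + 1) :=
    hv.weak.weak.weak.add (.const 1)
  refine .and (.imp (.eq hbit (.const 1)) (.not (.ex hk (.ex hl.weak (.ex hl.weak.weak
    (.and ?_ (.and ?_ (.and ?_ ?_))))))))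
    (.imp (.eq hbit (.const 0)) (.not (.ex hk ?_)))
  · exact .knowledge hl.weak.weak.weak hb.weak.weak.weak hy.weak.weak.weak Comp.last.weak.weak
      Comp.last.weak
  · exact .knowledge hl.weak.weak.weak hb.weak.weak.weak hy.weak.weak.weak
      (Comp.last.weak.weak.add (.const 1)) Comp.last
  · exact .lt Comp.last.weak h1
  · exact .lt h1 Comp.last
  · exact .knowledge hl.weak hb.weak hy.weak Comp.last (hv.weak.add (.const 1))

theorem CompP.chk {d : ℕ} (f : ℕ) : ∀ {α : Type} [Ctx α] {l b y j p bit : Input → α → ℕ},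
    Comp l → Comp b → Comp y → Comp j → Comp p → Comp bit →
    CompP (fun I a => (netOf I.data).Chk (I.data 0) (l I a) (knownFrom d I (l I a) (b I a) (y I a))
      f (j I a) (p I a) (bit I a)) := by
  induction f with
  | zero =>
    intro α _ l b y j p bit hl hb hy hj _ hbit
    exact .imp (.lt hj .net_n) (.inputOK hl hb hy hj hbit)
  | succ f ih =>
    intro α _ l b y j p bit hl hb hy hj hp hbit
    have hu : CompP (fun I a => Universal ((netOf I.data).kind (j I a)) (bit I a)) :=
      .universal hj.net_kind hbit
    have hc := ih (hl.weak (β := ℕ)) hb.weak hy.weak (hj.weak.net_arg .last)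
      (.child hp.weak hj.weak.net_len .last) (.flip hj.weak.net_kind hbit.weak)
    refine .and (.imp (.lt hj .net_n) (.inputOK hl hb hy hj hbit))
      (.imp (.le .net_n hj) (.and (.imp hu (.all hj.net_len hc))
        (.imp hu.not (.ex hj.net_len (.and ?_ hc)))))
    refine .imp (.ne_zero hp.weak) (.all hl.weak (.imp ?_ (.eq .last Comp.last.weak)))
    exact .knowledge hl.weak.weak hb.weak.weak hy.weak.weak
      (.add (.add (Comp.const 0).get (.const 1)) hp.weak.weak) .last

/-- The constraints on tuples of variables that are computed from the word of an instance. -/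
def Admits (d : ℕ) (I : Input) (l b y : ℕ) : Prop :=
  (netOf I.data).Local d (I.data 0) l (I.data 3) b y

theorem CompP.constraint {d : ℕ} {l b y : Input → α → ℕ} (hl : Comp l) (hb : Comp b)
    (hy : Comp y) : CompP (fun I a => Admits d I (l I a) (b I a) (y I a)) := by
  have hk : ∀ {β : Type} [Ctx β], Comp (fun I (_ : β) => I.data 0 + 1) :=
    (Comp.const 0).get.add (.const 1)
  refine .and (.all hl (.imp (.knowledge hl.weak hb.weak hy.weak (.const 0) .last)
    (.eq .last (.const 0)))) (.and ?_ (.and ?_ ?_))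
  · exact .all hl (.imp (.knowledge hl.weak hb.weak hy.weak hk .last)
      (.eq .last (.add .net_n (.const 1))))
  · refine .all hk (.all hl.weak (.all hl.weak.weak (.imp ?_ (.imp ?_ ?_))))
    · exact .knowledge hl.weak.weak.weak hb.weak.weak.weak hy.weak.weak.weak Comp.last.weak.weak
        Comp.last.weak
    · exact .knowledge hl.weak.weak.weak hb.weak.weak.weak hy.weak.weak.weak
        (Comp.last.weak.weak.add (.const 1)) Comp.last
    · exact .lt Comp.last.weak .last
  · exact .chk d hl hb hy (Comp.const 3).get (.const 1) (.const 1)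

theorem Comp.leaves {A : Input → α → ℕ} (hA : Comp A) (M : ℕ) :
    Comp (fun I a => leaves (A I a) M) := (hA.pow M).mul (.const M)

theorem Comp.mid {A D j x : Input → α → ℕ} (hA : Comp A) (M : ℕ) (hD : Comp D) (hj : Comp j)
    (hx : Comp x) : Comp (fun I a => mid (A I a) M (D I a) (j I a) (x I a)) :=
  .add (.add (.const 2) (hA.leaves M)) (.add (.mul hj hD) hx)

theorem Comp.left {A D j x : Input → α → ℕ} (hA : Comp A) (M : ℕ) (hD : Comp D) (hj : Comp j)
    (hx : Comp x) : Comp (fun I a => left (A I a) M (D I a) (j I a) (x I a)) :=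
  .add (.add (.add (.const 2) (hA.leaves M)) (.mul (hA.leaves M) hD)) (.add (.mul hj hD) hx)

theorem Comp.right {A D j x : Input → α → ℕ} (hA : Comp A) (M : ℕ) (hD : Comp D) (hj : Comp j)
    (hx : Comp x) : Comp (fun I a => right (A I a) M (D I a) (j I a) (x I a)) :=
  .add (.add (.add (.add (.const 2) (hA.leaves M)) (.mul (hA.leaves M) hD)) (.mul hA hD))
    (.add (.mul hj (hD.pow M)) hx)

theorem Comp.order {A D : Input → α → ℕ} (hA : Comp A) (M : ℕ) (hD : Comp D) :
    Comp (fun I a => order (A I a) M (D I a)) :=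
  .add (.add (.add (.add (.const 2) (hA.leaves M)) (.mul (hA.leaves M) hD)) (.mul hA hD))
    (.mul (hA.pow M) (hD.pow M))

theorem Comp.arcs {d : ℕ} {l u v : Input → α → ℕ} (hl : Comp l) (hu : Comp u) (hv : Comp v) :
    Comp (fun I a => arcs (Net.vars d (I.data 0)) (width d) (l I a) (Admits d I (l I a))
      (u I a) (v I a)) := by
  classical
  have hA : ∀ {β : Type} [Ctx β], Comp (fun I (_ : β) => Net.vars d (I.data 0)) := .vars d
  refine .ite (.or (.and (.eq hu (.const 0)) (.ex hA (.ex hl.weak (.eq hv.weak.weak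
    (.left hA _ hl.weak.weak Comp.last.weak .last))))) (.or ?_ ?_)) (.const 2)
    (.ite (.ex (hA.pow _) (.ex (.const _) (.or ?_ ?_))) (.const 1) (.const 0))
  · exact .and (.eq hu (.const 1)) (.ex (hA.pow _) (.ex (hl.weak.pow _) (.and (.eq hv.weak.weak
      (.right hA _ hl.weak.weak Comp.last.weak .last))
      (.constraint hl.weak.weak Comp.last.weak .last))))
  · exact .ex (hA.leaves _) (.ex hl.weak (.and (.eq hu.weak.weak
      (.mid hA _ hl.weak.weak Comp.last.weak .last))
      (.eq hv.weak.weak (.add (.const 2) Comp.last.weak))))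
  · exact .ex hl.weak.weak (.and (.eq hu.weak.weak.weak (.left hA _ hl.weak.weak.weak
      (.dig hA Comp.last.weak.weak Comp.last.weak) .last))
      (.eq hv.weak.weak.weak (.mid hA _ hl.weak.weak.weak
        (.add (.mul Comp.last.weak.weak (.const _)) Comp.last.weak) .last)))
  · exact .ex (hl.weak.weak.pow _) (.and (.eq hu.weak.weak.weak (.right hA _ hl.weak.weak.weak
      Comp.last.weak.weak .last))
      (.eq hv.weak.weak.weak (.mid hA _ hl.weak.weak.weak
        (.add (.mul Comp.last.weak.weak (.const _)) Comp.last.weak)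
        (.dig hl.weak.weak.weak .last Comp.last.weak))))

theorem CompP.pat {u v : Input → α → ℕ} (hu : Comp u) (hv : Comp v) :
    CompP (fun I a => pat (u I a) (v I a)) :=
  .and (.lt hu (.const 2)) (.le (.const 2) hv)

/-- The words of instances of Directed Steiner Network can be written in polynomial time. -/
theorem emit_code {V T b : Input → α → ℕ} {W : Input → α → ℕ → ℕ → ℕ} {P : ℕ → ℕ → Prop}
    (hV : Comp V) (hT : Comp T) (hb : Comp b)
    (hW : ∀ {u v : Input → α × ℕ → ℕ}, Comp u → Comp v →
      Comp (fun I a => W I a.1 (u I a) (v I a)))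
    (hP : ∀ {u v : Input → α × ℕ → ℕ}, Comp u → Comp v → CompP (fun I a => P (u I a) (v I a))) :
    Emit (fun I a => T I a :: V I a :: b I a ::
      ((List.range (V I a)).map (fun v => ind (v < T I a)) ++
      ((List.range (V I a * V I a)).map (fun i => W I a (i / V I a) (i % V I a)) ++
      (List.range (V I a * V I a)).map fun i =>
        ind (i / V I a < T I a ∧ i % V I a < T I a ∧ P (i / V I a) (i % V I a))))) := by
  have h1 := Comp.emit_range (F := fun I a v => ind (v < T I a)) hV (CompP.lt Comp.last hT.weak)
  have hdiv := Comp.div Comp.last (hV.weak (β := ℕ))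
  have hmod := Comp.mod Comp.last (hV.weak (β := ℕ))
  have h2 := Comp.emit_range (F := fun I a i => W I a (i / V I a) (i % V I a)) (hV.mul hV)
    (hW hdiv hmod)
  have h3 := Comp.emit_range (F := fun I a i => ind (i / V I a < T I a ∧ i % V I a < T I a ∧
    P (i / V I a) (i % V I a))) (hV.mul hV)
    (CompP.and (.lt hdiv hT.weak) (.and (.lt hmod hT.weak) (hP hdiv hmod)))
  exact hT.emit.append (hV.emit.append (hb.emit.append (h1.append (h2.append h3))))

end RAM

namespace Param

open RAM Net Steiner Steiner.Gadget

/-- The memory of a machine that has received an instance. -/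
def WCSInstance.input {d : ℕ} (J : WCSInstance d) : Input where
  data := letter J.circuit J.k
  size := J.k + (J.k :: J.circuit.encode).length
  le := letter_le

theorem computable_pow {f : ℕ → ℕ} (hf : Computable f) : ∀ n : ℕ, Computable fun k => f k ^ n
  | 0 => by simpa using Computable.const 1
  | n + 1 => by
    simpa only [pow_succ] using Primrec.nat_mul.to_comp.comp (computable_pow hf n) hf

/-- Reductions from Weighted Circuit Satisfiability that run in polynomial time compose with
parameterized reductions. -/
theorem reducible_of_emit {P Q : Problem} {d : ℕ} (hP : Reducible P (WCS d))
    (R : WCSInstance d → Q.Inst) (hyes : ∀ J, (WCS d).yes J ↔ Q.yes (R J))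
    (hparam : ∀ J, Q.param (R J) ≤ 2 + leaves (vars d J.k) (width d))
    {L : Input → ℕ → List ℕ} (hL : Emit L)
    (hword : ∀ J, L J.input (J.k :: J.circuit.encode).length = Q.word (R J)) :
    Reducible P Q := by
  obtain ⟨(r : P.Inst → WCSInstance d), p, f, g, c, hf, hg, h1, h2, h3⟩ := hP
  obtain ⟨N, hN, hp⟩ :=
    ((Filter.eventually_gt_atTop 0).and p.eventually_below).exists
  obtain ⟨T, ⟨e, hT⟩, hL⟩ := hL
  obtain ⟨q, hq⟩ := hL N (N + 1) (fun v => v N) (good_nat N.lt_succ_self)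
  have hadd : ∀ {u v : ℕ → ℕ}, Computable u → Computable v → Computable fun k => u k + v k :=
    fun hu hv => Primrec.nat_add.to_comp.comp hu hv
  have hmul : ∀ {u v : ℕ → ℕ}, Computable u → Computable v → Computable fun k => u k * v k :=
    fun hu hv => Primrec.nat_mul.to_comp.comp hu hv
  refine ⟨fun i => R (r i), .seq (p.divert N) q,
    fun k => 6 * f k + (g k + 2 * f k + 2) ^ e,
    fun k => 2 + (g k + 1 + 2 ^ (d + 1)) ^ width d * width d, c * e + c, ?_, ?_,
    fun i => (h1 i).trans (hyes _), fun i => ?_, fun i => ?_⟩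
  · exact hadd (hmul (.const 6) hf)
      (computable_pow (hadd (hadd hg (hmul (.const 2) hf)) (.const 2)) e)
  · exact hadd (.const 2) (hmul (computable_pow (hadd (hadd hg (.const 1)) (.const _)) _)
      (.const _))
  · refine (hparam (r i)).trans (Nat.add_le_add_left (Nat.mul_le_mul_right _
      (Nat.pow_le_pow_left ?_ _)) 2)
    have : (r i).k ≤ g (P.param i) := h2 i
    unfold vars; omega
  · obtain ⟨τ, t, hr, hout, ht⟩ := h3 i
    have hout' : τ.out = (r i).k :: (r i).circuit.encode := hout
    have hlen := hr.length_out
    obtain ⟨τ', t', hr', hm, ht'⟩ := hr.divert hp (mirror_init hN _)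
    obtain ⟨υ, s, hr'', k1, -, -, k4⟩ := hq (r i).input τ' (by
      rw [hm.tape, hout']
      rfl)
    have hl : τ'.var N = ((r i).k :: (r i).circuit.encode).length := by rw [hm.count, hout']
    rw [hl] at k1 k4
    refine ⟨υ, _, hr'.seq hr'', by rw [k1, hm.out, List.nil_append]; exact hword (r i), ?_⟩
    have hs : (State.init (P.word i)).out.length = 0 := rfl
    rw [hout', hs, zero_add] at hlen
    have hk : (r i).k ≤ g (P.param i) := h2 i
    have k5 : s ≤ ((r i).k + ((r i).k :: (r i).circuit.encode).length +
        ((r i).k :: (r i).circuit.encode).length + 2) ^ e := k4.trans (hT _ _)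
    generalize ((r i).k :: (r i).circuit.encode).length = l at *
    set F := f (P.param i)
    set G := g (P.param i)
    set X := bitSize (P.encode i) + 1
    have hX : 1 ≤ X ^ c := Nat.one_le_pow _ _ (Nat.succ_pos _)
    have hXe : 1 ≤ X ^ (c * e) := Nat.one_le_pow _ _ (Nat.succ_pos _)
    have b1 : (r i).k + l + l + 2 ≤ (G + 2 * F + 2) * X ^ c := by
      have : G ≤ G * X ^ c := Nat.le_mul_of_pos_right _ hX
      calc (r i).k + l + l + 2 ≤ G * X ^ c + 2 * (F * X ^ c) + 2 * X ^ c := by omega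
        _ = _ := by ring
    have b2 : s ≤ (G + 2 * F + 2) ^ e * X ^ (c * e) := by
      rw [pow_mul, ← mul_pow]
      exact k5.trans (Nat.pow_le_pow_left b1 e)
    calc t' + s ≤ 6 * F * X ^ c + (G + 2 * F + 2) ^ e * X ^ (c * e) := by
          rw [mul_assoc]; omega
      _ ≤ 6 * F * X ^ (c * e + c) + (G + 2 * F + 2) ^ e * X ^ (c * e + c) := by
          rw [pow_add]
          exact Nat.add_le_add (Nat.mul_le_mul_left _ (Nat.le_mul_of_pos_left _ hXe))
            (Nat.mul_le_mul_left _ (Nat.le_mul_of_pos_right _ hX))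
      _ = _ := by ring

variable {d : ℕ}

/-- The network instance of a circuit: order, arcs and pattern. -/
def WCSInstance.order (J : WCSInstance d) : ℕ :=
  Gadget.order (vars d J.k) (width d) (J.k :: J.circuit.encode).length

noncomputable def WCSInstance.arcs (J : WCSInstance d) : ℕ → ℕ → ℕ :=
  Gadget.arcs (vars d J.k) (width d) (J.k :: J.circuit.encode).length
    (Admits d J.input (J.k :: J.circuit.encode).length)

def WCSInstance.terminals (J : WCSInstance d) : ℕ := 2 + leaves (vars d J.k) (width d)

theorem WCSInstance.terminals_le (J : WCSInstance d) : J.terminals ≤ J.order := by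
  unfold terminals order Gadget.order; omega

theorem WCSInstance.two_lt_terminals (J : WCSInstance d) : 2 < J.terminals := by
  have : 0 < leaves (vars d J.k) (width d) := by unfold leaves vars width; positivity
  unfold terminals; omega

theorem yes_iff_hasNetwork (J : WCSInstance d) : (WCS d).yes J ↔
    HasNetwork J.order J.terminals J.arcs pat (budget (vars d J.k) (width d)) := by
  have hout := J.circuit.output_lt
  have key := constraints_iff (C := netOf (letter J.circuit J.k)) (k := J.k) (d := d)
    (out := J.circuit.output) measure_netOf
    (by rw [word_length]; change J.circuit.inputs + 1 < _; omega) hout J.depth_le J.weft_le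
    (V := fun (x : Fin J.circuit.inputs → Bool) j => (valueAt J.circuit x j).toNat)
    (fun x => valuation_netOf x)
    (fun x (v : Fin J.circuit.inputs) => congrArg Bool.toNat (valueAt_input x v))
  have hsol : (WCS d).yes J ↔ ∃ x : Fin J.circuit.inputs → Bool,
      (Finset.univ.filter fun v => x v = true).card = J.k ∧
        (valueAt J.circuit x J.circuit.output).toNat = 1 := by
    refine exists_congr fun x => and_congr_right fun _ => ?_
    change valueAt J.circuit x J.circuit.output = true ↔ _
    cases valueAt J.circuit x J.circuit.output <;> simp
  rw [hsol]
  refine key.symm.trans ⟨?_, ?_⟩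
  · rintro ⟨x, hx, h⟩
    exact network_of_solution hx h
  · exact solution_of_network (by unfold width; positivity)

theorem emit_network {W : Input → ℕ → ℕ → ℕ → ℕ} {p : ℕ → ℕ → Prop}
    (hW : ∀ {α : Type} [Ctx α] {l u v : Input → α → ℕ}, Comp l → Comp u → Comp v →
      Comp (fun I a => W I (l I a) (u I a) (v I a)))
    (hp : ∀ {α : Type} [Ctx α] {u v : Input → α → ℕ}, Comp u → Comp v →
      CompP (fun I a => p (u I a) (v I a))) :
    ∃ L : Input → ℕ → List ℕ, Emit L ∧ ∀ J : WCSInstance d,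
      L J.input (J.k :: J.circuit.encode).length =
        J.terminals :: J.order :: budget (vars d J.k) (width d) ::
        ((List.range J.order).map (fun v => ind (v < J.terminals)) ++
        ((List.range (J.order * J.order)).map (fun i =>
          W J.input (J.k :: J.circuit.encode).length (i / J.order) (i % J.order)) ++
        (List.range (J.order * J.order)).map fun i => ind (i / J.order < J.terminals ∧
          i % J.order < J.terminals ∧ p (i / J.order) (i % J.order)))) := by
  have hl : Comp (fun _ (l : ℕ) => l) := .proj (fun _ _ h => h) fun _ => le_rfl
  have hA : Comp (fun I (_ : ℕ) => vars d (I.data 0)) := .vars d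
  exact ⟨_, emit_code (hA.order (width d) hl) (.add (.const 2) (hA.leaves (width d)))
    (.add (.add hA (hA.pow _)) (hA.leaves _)) (W := W) (fun hu hv => hW hl.weak hu hv) hp,
    fun J => rfl⟩

theorem w1Hard_pureOutDiamonds : W1Hard (DSN pureOutDiamonds) := by
  rintro P ⟨d, hP⟩
  obtain ⟨L, hL, hw⟩ := emit_network (d := d)
    (W := fun I l u v => Gadget.arcs (vars d (I.data 0)) (width d) l (Admits d I l) u v)
    (fun hl hu hv => Comp.arcs (d := d) hl hu hv)
    CompP.pat
  refine reducible_of_emit hP (fun J => codeInstance pureOutDiamonds J.order J.terminals J.arcs pat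
    (budget (vars d J.k) (width d)) (isPureOutDiamond_code J.terminals_le J.two_lt_terminals))
    (fun J => ?_) (fun J => (card_terminals J.terminals_le).le) hL fun J => (hw J).trans ?_
  · exact (yes_iff_hasNetwork J).trans
      (codeInstance_yes (WCSInstance.terminals_le (d := d) J) _).symm
  · exact congrArg₂ _ (card_terminals J.terminals_le).symm (codeInstance_encode _).symm

theorem w1Hard_pureInDiamonds : W1Hard (DSN pureInDiamonds) := by
  rintro P ⟨d, hP⟩
  obtain ⟨L, hL, hw⟩ := emit_network (d := d)
    (W := fun I l u v => Gadget.arcs (vars d (I.data 0)) (width d) l (Admits d I l) v u)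
    (p := fun s t => pat t s)
    (fun hl hu hv => Comp.arcs (d := d) hl hv hu) fun hu hv => CompP.pat hv hu
  refine reducible_of_emit hP (fun J => codeInstance pureInDiamonds J.order J.terminals
    (fun u v => J.arcs v u) (fun s t => pat t s) (budget (vars d J.k) (width d))
    (isPureInDiamond_code J.terminals_le J.two_lt_terminals))
    (fun J => ?_) (fun J => (card_terminals J.terminals_le).le) hL fun J => (hw J).trans ?_
  · exact ((yes_iff_hasNetwork J).trans ⟨HasNetwork.swap, HasNetwork.swap⟩).trans
      (codeInstance_yes (WCSInstance.terminals_le (d := d) J) _).symm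
  · exact congrArg₂ _ (card_terminals J.terminals_le).symm
      (codeInstance_encode (W := fun u v => J.arcs v u) (pat := fun s t => pat t s) _).symm

end Param

theorem mainTheorem8 :
    Param.W1Hard (Steiner.DSN Steiner.pureOutDiamonds) ∧
      Param.W1Hard (Steiner.DSN Steiner.pureInDiamonds) :=
  ⟨Param.w1Hard_pureOutDiamonds, Param.w1Hard_pureInDiamonds⟩
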